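/- Let $\mathcal M$ be a finite set of Bayesian models for a fixed data set $\mathbf y$ of $n\ge 1$ observations. Model $\mathfrak m$ has prior probability $p(\mathfrak m)>0$, $\sum_{\mathfrak m}p(\mathfrak m)=1$, a parameter $\theta\in\mathbb R^{d_{\mathfrak m}}$ with prior density $p(\theta\mid\mathfrak m)>0$, and a positive likelihood $p(\mathbf y\mid\theta,\mathfrak m)$; put $\ell_{\mathfrak m}(\theta)=\ln p(\mathbf y\mid\theta,\mathfrak m)$. For each model, at a parameter value $\theta$, let $\hat p_{\theta}(\mathbf y\mid\mathfrak m)$ be the exact marginal likelihood $\int p(\mathbf y\mid\theta',\mathfrak m)\,p(\theta'\mid\mathfrak m)\,d\theta'$ if it is available, and $\exp\bigl(\ell_{\mathfrak m}(\theta)-\tfrac{d_{\mathfrak m}}2\ln n\bigr)$ otherwise. Let $p_L(\mathbf y\mid\mathfrak m)$ be its value at the maximum likelihood estimate $\theta_{\mathrm{MLE},\mathfrak m}$, and let $\pi(\mathfrak m)=p_L(\mathbf y\mid\mathfrak m)p(\mathfrak m)/\sum_{\mathfrak m'}p_L(\mathbf y\mid\mathfrak m')p(\mathfrak m')$. Assume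 for every $\mathfrak m\in\mathcal M$: 1. $\ell_{\mathfrak m}$ is differentiable, and $\ell_{\mathfrak m}$ and $\nabla\ell_{\mathfrak m}$ are Lipschitz continuous; 2. $\ell_{\mathfrak m}$ is strictly concave; 3. $-\ell_{\mathfrak m}(\theta)\to\infty$ as $\|\theta\|\to\infty$; 4. $\liminf_{\|\theta\|\to\infty}\|\nabla\ell_{\mathfrak m}(\theta)\|>0$; 5. there is a stochastic first order oracle $V_{\mathfrak m}(\theta;w)=\nabla\ell_{\mathfrak m}(\theta)+Z_{\mathfrak m}(\theta;w)$ with $E\,Z_{\mathfrak m}(\theta;w)=0$ and $E\|Z_{\mathfrak m}(\theta;w)\|^{q_{\mathfrak m}}\le\sigma_{\mathfrak m}^{q_{\mathfrak m}}$ for all $\theta$, where $q_{\mathfrak m}\ge2$, $\sigma_{\mathfrak m}\ge0$; 6. the step sizes $\alpha_{\mathfrak m,\tau}>0$, $\tau=1,2,\dots$, satisfy $\alpha_{\mathfrak m,\tau}=\Theta(\tau^{-l_{\mathfrak m}})$ with $l_{\mathfrak m}\in(2/(q_{\mathfrak m}+2),1]$. Let $q_r(\cdot\mid\mathfrak m)$,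 $r\in R$, be finitely many proposal kernels on $\mathcal M$ with positive mixture weights, one of which, $q_{r'}$, satisfies $q_{r'}(\mathfrak m^\star\mid\mathfrak m)>0$ for all $\mathfrak m,\mathfrak m^\star$. Let $U\ge1$, $p_{\mathrm{rand}}\in[0,1]$, $\sigma_{\mathrm{rand}}\ge0$ and $0<\epsilon\le\min_{\mathfrak m}p_L(\mathbf y\mid\mathfrak m)$. Consider the following algorithm, started at any (possibly random) model $\mathfrak m^{(0)}$ and any (possibly random) parameter value for each model, with $\hat p^{\mathrm{opt},0}(\mathbf y\mid\mathfrak m)=\epsilon$ for all $\mathfrak m$. In iteration $s=1,2,\dots$, with $\mathfrak m=\mathfrak m^{(s-1)}$: * Draw $r$ from the mixture weights and $\mathfrak m^\star\sim q_r(\cdot\mid\mathfrak m)$. * For the model $\mathfrak m^\star$, run at least one and at most $U$ iterations $\theta\leftarrow\theta+\alpha_{\mathfrak m^\star,\tau}V_{\mathfrak m^\star}(\theta;w)$ of batch stochastic gradient descent (BSGD), with a fresh independent $w$ in each, starting from the parameter value at which BSGD stopped at the previous visit of $\mathfrak m^\star$ (from the initial value at the first visit) and continuing its step-size sequence. The number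 of iterations may depend on what has been observed so far, but not on the future. * Let $\hat\theta$ be the result; with probability $p_{\mathrm{rand}}$ (independently) add to $\hat\theta$ an independent $N(0,\sigma_{\mathrm{rand}}^2I)$ vector, which does not affect the value from which BSGD is continued later. * Put $\hat p^{\mathrm{opt},s}(\mathbf y\mid\mathfrak m^\star)=\max\{\hat p^{\mathrm{opt},s-1}(\mathbf y\mid\mathfrak m^\star),\hat p_{\hat\theta}(\mathbf y\mid\mathfrak m^\star)\}$, and $\hat p^{\mathrm{opt},s}=\hat p^{\mathrm{opt},s-1}$ for all other models. * Put $\mathfrak m^{(s)}=\mathfrak m^\star$ with probability $$r^\star_{mh}(\mathfrak m,\mathfrak m^\star;s)=\min\Bigl\{1,\frac{\hat p^{\mathrm{opt},s}(\mathbf y\mid\mathfrak m^\star)\,p(\mathfrak m^\star)\,q_r(\mathfrak m\mid\mathfrak m^\star)}{\hat p^{\mathrm{opt},s}(\mathbf y\mid\mathfrak m)\,p(\mathfrak m)\,q_r(\mathfrak m^\star\mid\mathfrak m)}\Bigr\},$$ and $\mathfrak m^{(s)}=\mathfrak m$ otherwise. Then, almost surely, for every $\mathfrak m\in\mathcal M$,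 $$\hat p^{(t)}_{MC}(\mathfrak m\mid\mathbf y)=\frac1t\sum_{s=1}^t\mathbb 1(\mathfrak m^{(s)}=\mathfrak m)\longrightarrow\pi(\mathfrak m)\qquad(t\to\infty).$$ In particular, this holds whenever in addition the adaptive transition kernel $q_r(\mathfrak m^\star\mid\mathfrak m)\,r^\star_{mh}(\mathfrak m,\mathfrak m^\star;t)$ satisfies assumption A3 and conditions (i)–(iii) of Theorem 2.11 of Fort et al. (2011). -/

import Mathlib

open MeasureTheory ProbabilityTheory Filter Topology Asymptotics
open scoped NNReal ENNReal

noncomputable section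

/-- The parameter space of a model with `d` parameters. -/
abbrev Params (d : ℕ) : Type := EuclideanSpace ℝ (Fin d)

/-! ### Models, marginal likelihoods and the target -/

/-- A finite class `M` of Bayesian models for one fixed data set of `n` observations.
The likelihood of model `m` is `p(y | θ, m) = exp (logLik m θ)`. -/
structure ModelFamily (M : Type*) [Fintype M] where
  n : ℕ
  n_pos : 0 < n
  /-- number of parameters of each model -/
  dim : M → ℕ
  /-- `ln p(y | θ, m)` -/
  logLik : (m : M) → Params (dim m) → ℝ
  /-- prior density `p(θ | m)` -/
  paramPrior : (m : M) → Params (dim m) → ℝ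
  paramPrior_pos : ∀ m θ, 0 < paramPrior m θ
  paramPrior_integrable : ∀ m, Integrable (paramPrior m)
  paramPrior_integral : ∀ m, ∫ θ, paramPrior m θ = 1
  /-- prior model probabilities `p(m)` -/
  modelPrior : M → ℝ
  modelPrior_pos : ∀ m, 0 < modelPrior m
  modelPrior_sum : ∑ m, modelPrior m = 1
  /-- the models whose exact marginal likelihood is available -/
  available : M → Prop

namespace ModelFamily

variable {M : Type*} [Fintype M] (𝓜 : ModelFamily M)

/-- The exact marginal likelihood `p(y | m) = ∫ p(y | m, θ) p(θ | m) dθ`. -/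
def marginalLik (m : M) : ℝ :=
  ∫ θ, Real.exp (𝓜.logLik m θ) * 𝓜.paramPrior m θ

/-- The (large sample) Laplace approximation with `θ` in the place of the maximum likelihood
estimate: `ln p̃(y | m) = ln p(y | θ, m) - (|θ| / 2) ln n`. -/
def laplaceAt (m : M) (θ : Params (𝓜.dim m)) : ℝ :=
  Real.exp (𝓜.logLik m θ - (𝓜.dim m : ℝ) / 2 * Real.log 𝓜.n)

/-- The maximum likelihood estimate: a maximiser of the likelihood (arbitrary if there is none). -/
def mle (m : M) : Params (𝓜.dim m) :=
  Classical.epsilon fun θ => ∀ θ', 𝓜.logLik m θ' ≤ 𝓜.logLik m θ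

open Classical in
/-- The value for the marginal likelihood of `m` that is computed from the parameter value `θ`:
the exact one if it is available, and the Laplace approximation at `θ` otherwise. -/
def evalLik (m : M) (θ : Params (𝓜.dim m)) : ℝ :=
  if 𝓜.available m then 𝓜.marginalLik m else 𝓜.laplaceAt m θ

/-- `p_L(y | m)`: the exact marginal likelihood if it is available, and the Laplace approximation
(at the maximum likelihood estimate) otherwise. -/
def targetLik (m : M) : ℝ := 𝓜.evalLik m (𝓜.mle m)

/-- The target model probabilities `π(m)`, that is `p_L(y | m) p(m)` renormalised over `M`. -/
def target (m : M) : ℝ :=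
  𝓜.targetLik m * 𝓜.modelPrior m / ∑ m', 𝓜.targetLik m' * 𝓜.modelPrior m'

end ModelFamily

/-! ### Regularity conditions on a log-likelihood `ℓ` -/

/-- `ℓ` is differentiable, and `ℓ` and its gradient are Lipschitz continuous. -/
def LipschitzLogLik {d : ℕ} (ℓ : Params d → ℝ) : Prop :=
  Differentiable ℝ ℓ ∧ (∃ G : ℝ≥0, LipschitzWith G ℓ) ∧ ∃ L : ℝ≥0, LipschitzWith L (gradient ℓ)

/-- `-ℓ` is coercive. -/
def CoerciveLogLik {d : ℕ} (ℓ : Params d → ℝ) : Prop :=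
  Tendsto (fun θ => -ℓ θ) (cocompact (Params d)) atTop

/-- `liminf ‖∇ (-ℓ)(θ)‖ > 0` as `‖θ‖ → ∞`. -/
def AsymptoticallyFlatCond {d : ℕ} (ℓ : Params d → ℝ) : Prop :=
  ∃ c : ℝ, 0 < c ∧ ∀ᶠ θ in cocompact (Params d), c ≤ ‖gradient (fun θ => -ℓ θ) θ‖

/-- `V(θ; w)`, with `w` drawn from `ν`, is a stochastic first order oracle for `∇ ℓ`: the error
`V(θ; w) - ∇ ℓ(θ)` has mean zero and `q`-th moment at most `σ ^ q`. -/
structure IsFirstOrderOracle {W : Type*} [MeasurableSpace W] (ν : Measure W) {d : ℕ}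
    (ℓ : Params d → ℝ) (V : Params d → W → Params d) (q σ : ℝ) : Prop where
  two_le : 2 ≤ q
  sigma_nonneg : 0 ≤ σ
  measurable : Measurable (Function.uncurry V)
  integrable : ∀ θ, Integrable (fun w => V θ w - gradient ℓ θ) ν
  mean_zero : ∀ θ, ∫ w, (V θ w - gradient ℓ θ) ∂ν = 0
  moment_le : ∀ θ, ∫⁻ w, ‖V θ w - gradient ℓ θ‖ₑ ^ q ∂ν ≤ ENNReal.ofReal (σ ^ q)

/-- `α τ`, for `τ = 1, 2, …`, is a sequence of positive step sizes with `α τ = Θ(1 / τ ^ l)`. -/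
def IsStepSize (α : ℕ → ℝ) (l : ℝ) : Prop :=
  (∀ τ, 1 ≤ τ → 0 < α τ) ∧ α =Θ[atTop] fun τ : ℕ => 1 / (τ : ℝ) ^ l

/-! ### The MCMC algorithm with BSGD -/

/-- A mixture of proposal kernels on `M`: kernel `r` is used with probability `weight r`, and
`q r m m'` is the probability `q_r(m' | m)` that it proposes `m'` when the chain is at `m`. One of
the kernels proposes every model from every model. -/
structure ProposalMixture (R M : Type*) [Fintype R] [Fintype M] where
  weight : R → ℝ
  weight_pos : ∀ r, 0 < weight r
  weight_sum : ∑ r, weight r = 1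
  q : R → M → M → ℝ
  q_nonneg : ∀ r m m', 0 ≤ q r m m'
  q_sum : ∀ r m, ∑ m', q r m m' = 1
  exists_pos : ∃ r, ∀ m m', 0 < q r m m'

/-- The current state of the algorithm. -/
structure AlgState {M : Type*} (dim : M → ℕ) where
  /-- current model of the chain -/
  model : M
  /-- parameter values at which BSGD last stopped, for each model -/
  theta : (m : M) → Params (dim m)
  /-- number of BSGD iterations made so far, for each model -/
  tau : M → ℕ
  /-- best marginal likelihood found so far, for each model -/
  popt : M → ℝ

/-- The random input of one iteration of the algorithm: the kernel that is drawn and the model that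
it proposes; the seeds of the calls of the gradient oracle; whether the result of BSGD is to be
randomised; the standard normal vectors for this randomisation; the uniform variable of the
accept/reject step. -/
abbrev Input (R : Type*) {M : Type*} (W : Type*) (dim : M → ℕ) : Type _ :=
  (R × M) × (ℕ → W) × Bool × ((m : M) → Params (dim m)) × ℝ

/-- The law of the input of an iteration that starts with the chain at model `m`. -/
def inputLaw {R M W : Type*} [Fintype R] [Fintype M] [MeasurableSpace R] [MeasurableSpace M]
    [MeasurableSpace W] (Q : ProposalMixture R M) (ν : Measure W) [IsProbabilityMeasure ν]
    (pRand : ℝ) (dim : M → ℕ) (m : M) : Measure (Input R W dim) :=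
  (∑ r, ∑ m', ENNReal.ofReal (Q.weight r * Q.q r m m') • Measure.dirac (r, m')).prod
    ((Measure.infinitePi fun _ : ℕ => ν).prod
      ((ENNReal.ofReal pRand • Measure.dirac true
          + ENNReal.ofReal (1 - pRand) • Measure.dirac false).prod
        ((Measure.pi fun m' : M => stdGaussian (Params (dim m'))).prod
          (volume.restrict (Set.Icc (0 : ℝ) 1)))))

/-- BSGD (maximising the log-likelihood) that is started at `θ₀` after `τ₀` earlier iterations:
its value after `k` more iterations, with the oracle seeds `w 0, w 1, …`. -/
def bsgd {W : Type*} {d : ℕ} (α : ℕ → ℝ) (V : Params d → W → Params d) (w : ℕ → W)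
    (θ₀ : Params d) (τ₀ : ℕ) : ℕ → Params d
  | 0 => θ₀
  | k + 1 => bsgd α V w θ₀ τ₀ k + α (τ₀ + k + 1) • V (bsgd α V w θ₀ τ₀ k) (w k)

/-- The Metropolis–Hastings acceptance probability `r*(m, m')` of kernel `r`, computed from the
estimates `p` of the marginal likelihoods. -/
def acceptProb {R M : Type*} [Fintype R] [Fintype M] (𝓜 : ModelFamily M)
    (Q : ProposalMixture R M) (p : M → ℝ) (r : R) (m m' : M) : ℝ :=
  min 1 (p m' * 𝓜.modelPrior m' * Q.q r m' m / (p m * 𝓜.modelPrior m * Q.q r m m'))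

/-- One iteration of the algorithm with input `ξ`, when BSGD is run for `K` iterations: BSGD goes on
for the proposed model from where it stopped; its result, randomised if so drawn, is used for a
new estimate of the marginal likelihood of the proposed model; the best estimate so far is kept; the
proposed model is accepted or rejected with the updated estimates. -/
def algStep {R M W : Type*} [Fintype R] [Fintype M] [DecidableEq M] (𝓜 : ModelFamily M)
    (Q : ProposalMixture R M) (α : M → ℕ → ℝ)
    (V : (m : M) → Params (𝓜.dim m) → W → Params (𝓜.dim m)) (σRand : ℝ)
    (S : AlgState 𝓜.dim) (ξ : Input R W 𝓜.dim) (K : ℕ) : AlgState 𝓜.dim :=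
  let r : R := ξ.1.1
  let prop : M := ξ.1.2
  let w : ℕ → W := ξ.2.1
  let randomise : Bool := ξ.2.2.1
  let z : (m : M) → Params (𝓜.dim m) := ξ.2.2.2.1
  let u : ℝ := ξ.2.2.2.2
  let θ : (m : M) → Params (𝓜.dim m) := fun m =>
    if m = prop then bsgd (α m) (V m) w (S.theta m) (S.tau m) K else S.theta m
  let θhat : Params (𝓜.dim prop) := if randomise then θ prop + σRand • z prop else θ prop
  let p : M → ℝ := fun m =>
    if m = prop then max (S.popt m) (𝓜.evalLik prop θhat) else S.popt m
  { model := if u ≤ acceptProb 𝓜 Q p r S.model prop then prop else S.model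
    theta := θ
    tau := fun m => if m = prop then S.tau m + K else S.tau m
    popt := p }

/-- `S 0, S 1, …` are the successive states of a run of the algorithm, with inputs `ξ` and numbers
`K` of BSGD iterations; `ℱ s` is the history of the first `s` iterations. In every iteration BSGD
is run for at least one and at most `U` iterations, and whether it is stopped after `k` of them may
depend only on what has been observed until then. -/
structure IsRun {R M W Ω : Type*} [Fintype R] [Fintype M] [DecidableEq M] [MeasurableSpace R]
    [MeasurableSpace M] [MeasurableSpace W] {mΩ : MeasurableSpace Ω} (μ : Measure Ω)
    (𝓜 : ModelFamily M) (Q : ProposalMixture R M) (ν : Measure W) [IsProbabilityMeasure ν]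
    (V : (m : M) → Params (𝓜.dim m) → W → Params (𝓜.dim m)) (α : M → ℕ → ℝ) (U : ℕ)
    (pRand σRand ε : ℝ) (ℱ : Filtration ℕ mΩ) (S : ℕ → Ω → AlgState 𝓜.dim)
    (ξ : ℕ → Ω → Input R W 𝓜.dim) (K : ℕ → Ω → ℕ) : Prop where
  init_model : Measurable[ℱ 0] fun ω => (S 0 ω).model
  init_theta : ∀ m, Measurable[ℱ 0] fun ω => (S 0 ω).theta m
  init_tau : ∀ ω m, (S 0 ω).tau m = 0
  init_popt : ∀ ω m, (S 0 ω).popt m = ε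
  step : ∀ s ω, S (s + 1) ω = algStep 𝓜 Q α V σRand (S s ω) (ξ s ω) (K s ω)
  input_measurable : ∀ s, Measurable[ℱ (s + 1)] (ξ s)
  /-- Given the history, the input of the next iteration has the law `inputLaw`. -/
  input_law : ∀ s (A : Set (Input R W 𝓜.dim)), MeasurableSet A →
    μ[(ξ s ⁻¹' A).indicator (fun _ => (1 : ℝ)) | ℱ s]
      =ᵐ[μ] fun ω => (inputLaw Q ν pRand 𝓜.dim (S s ω).model).real A
  K_pos : ∀ s ω, 1 ≤ K s ω
  K_le : ∀ s ω, K s ω ≤ U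
  K_stopping : ∀ s k, MeasurableSet[ℱ s ⊔ MeasurableSpace.comap (fun ω => (ξ s ω).1) inferInstance
      ⊔ ⨆ j : Fin k, MeasurableSpace.comap (fun ω => (ξ s ω).2.1 j) inferInstance]
    {ω | K s ω = k}

/-- The Monte Carlo estimate `t⁻¹ ∑_{s = 1}^t 1(m^{(s)} = m)` of the probability of model `m`. -/
def mcEstimate {M : Type*} [DecidableEq M] (X : ℕ → M) (t : ℕ) (m : M) : ℝ :=
  (t : ℝ)⁻¹ * ∑ s ∈ Finset.Icc 1 t, if X s = m then 1 else 0

end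

/-!
Two facts are combined: the estimates of the marginal likelihoods converge to the values `p_L`
although the optimiser may be stopped at unfavourable times and its results may be randomised, and
the model frequencies of a Metropolis–Hastings chain whose acceptance probabilities converge are
those of the limiting chain.

*Estimates.* The estimate of a model is nondecreasing and bounded by `p_L`, so it is enough that it
comes arbitrarily close to `p_L`. Hence no convergence of the BSGD iterates is needed, but only that
the gap between the log-likelihood and its maximum is below any `δ > 0` infinitely often. As long
as the gap is at least `δ`, the norm of the gradient is bounded below, by concavity and the
behaviour at infinity (`exists_le_norm_gradient`). Then an iteration of the algorithm decreases the
expected gap by a multiple of the step size of the first BSGD iteration in it; the second order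
errors of the at most `U` BSGD iterations are negligible in comparison, and the stopping rule is
harmless because an oracle call has a seed that is independent of all that precedes it
(`IsRun.setLIntegral_gap_theta_succ_le`). The step size in iteration `s` is at least of order
`1 / s` and every model is proposed with a probability that is bounded below, so the gap, which is
nonnegative, cannot stay above `δ` (`IsRun.measure_forall_le_gap_eq_zero`). This argument needs only
second moments of the oracle error, step sizes that tend to zero, and the divergence of their sum.
By Lévy's extension of the Borel–Cantelli lemmas the randomising vector is small in infinitely many
of the iterations in which the gap is small (`IsRun.ae_frequently_and_noise_small`).

*Frequencies.* Replacing the estimates by `p_L` in the accept/reject step changes the decision only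
if the uniform variable is close to the limiting acceptance probability, which is rare. A law of
large numbers for bounded martingale differences (`ae_tendsto_average_zero`) then shows that the
transitions out of each model have in the long run the frequencies given by the transition matrix
`P` of the limiting chain (`IsRun.ae_tendsto_average_transition`). So the vector of model
frequencies is asymptotically invariant under `P`. As `P` is reversible with respect to the target
and has positive off-diagonal entries, an almost invariant distribution is close to the target, by a
maximum principle (`abs_sub_le_of_reversible`). Neither Poisson equations nor a diminishing
adaptation condition are involved.
-/

set_option linter.unusedSectionVars false

/-! ### General facts from probability theory -/

lemma exists_pos_forall_le {ι : Type*} [Finite ι] {f : ι → ℝ} (hf : ∀ i, 0 < f i) :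
    ∃ c, 0 < c ∧ ∀ i, c ≤ f i := by
  rcases isEmpty_or_nonempty ι with hι | hι
  · exact ⟨1, one_pos, fun i => (hι.false i).elim⟩
  · obtain ⟨i, hi⟩ := Finite.exists_min f
    exact ⟨f i, hf i, hi⟩

/-- A variable `w` that is independent of what is known can be integrated out while the rest is kept
fixed. -/
lemma setLIntegral_comp_of_indep {Ω β W : Type*} {m mΩ : MeasurableSpace Ω} [MeasurableSpace β]
    [MeasurableSpace W] {μ : Measure Ω} [IsProbabilityMeasure μ] (hm : m ≤ mΩ) {Y : Ω → β}
    (hY : Measurable[m] Y) {w : Ω → W} (hw : Measurable[mΩ] w)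
    (hi : Indep m (MeasurableSpace.comap w inferInstance) μ) {F : β × W → ℝ≥0∞}
    (hF : Measurable F) {D : Set Ω} (hD : MeasurableSet[m] D) :
    ∫⁻ ω in D, F (Y ω, w ω) ∂μ = ∫⁻ ω in D, ∫⁻ x, F (Y ω, x) ∂(μ.map w) ∂μ := by
  have hY' := hY.mono hm le_rfl
  set c : Ω → ℝ≥0∞ := D.indicator (fun _ => 1) with hc
  have hcm : Measurable[m] c := Measurable.indicator (@measurable_const _ _ _ m 1) hD
  have hcm' := hcm.mono hm le_rfl
  have hind : IndepFun (fun ω => (Y ω, c ω)) w μ := by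
    rw [IndepFun_iff_Indep]
    exact indep_of_indep_of_le_left hi (hY.prodMk hcm).comap_le
  have := Measure.isProbabilityMeasure_map (μ := μ) hw.aemeasurable
  have hG : Measurable fun x : (β × ℝ≥0∞) × W => x.1.2 * F (x.1.1, x.2) := by fun_prop
  have hind' : ∀ f : Ω → ℝ≥0∞, ∫⁻ ω in D, f ω ∂μ = ∫⁻ ω, c ω * f ω ∂μ := by
    intro f
    rw [← lintegral_indicator (hm D hD)]
    congr with ω
    by_cases hω : ω ∈ D <;> simp [hc, hω]
  rw [hind', hind']
  calc ∫⁻ ω, c ω * F (Y ω, w ω) ∂μ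
      = ∫⁻ x, x.1.2 * F (x.1.1, x.2) ∂(μ.map fun ω => ((Y ω, c ω), w ω)) :=
        (lintegral_map hG ((hY'.prodMk hcm').prodMk hw)).symm
    _ = ∫⁻ y, ∫⁻ x, y.2 * F (y.1, x) ∂(μ.map w) ∂(μ.map fun ω => (Y ω, c ω)) := by
        rw [(indepFun_iff_map_prod_eq_prod_map_map (hY'.prodMk hcm').aemeasurable
          hw.aemeasurable).1 hind, lintegral_prod _ hG.aemeasurable]
    _ = ∫⁻ ω, ∫⁻ x, c ω * F (Y ω, x) ∂(μ.map w) ∂μ :=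
        lintegral_map hG.lintegral_prod_right' (hY'.prodMk hcm')
    _ = _ := by
        congr with ω
        exact lintegral_const_mul _ (hF.comp measurable_prodMk_left)

/-- Lévy's extension of the Borel–Cantelli lemmas, for events `A s` that are decided at
time `s + 1`. -/
lemma ae_frequently_mem_iff_tendsto_sum_condExp {Ω : Type*} {mΩ : MeasurableSpace Ω}
    {μ : Measure Ω} [IsProbabilityMeasure μ] {ℱ : Filtration ℕ mΩ} {A : ℕ → Set Ω}
    (hA : ∀ s, MeasurableSet[ℱ (s + 1)] (A s)) :
    ∀ᵐ ω ∂μ, (∃ᶠ s in atTop, ω ∈ A s) ↔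
      Tendsto (fun n => ∑ k ∈ Finset.range n, (μ[(A k).indicator (1 : Ω → ℝ) | ℱ k]) ω)
        atTop atTop := by
  have h := ae_mem_limsup_atTop_iff μ (ℱ := ℱ) (s := fun n => Nat.casesOn n ∅ A) (fun n => by
    cases n with
    | zero => exact @MeasurableSet.empty _ (ℱ 0)
    | succ n => exact hA n)
  filter_upwards [h] with ω hω
  rw [← hω, ← Filter.limsup_nat_add _ 1, mem_limsup_iff_frequently_mem]
lemma indep_sup_of_measure_inter {Ω : Type*} {mΩ : MeasurableSpace Ω} {μ : Measure Ω}
    [IsProbabilityMeasure μ] {m₁ m₂ m₃ : MeasurableSpace Ω} (h₁ : m₁ ≤ mΩ) (h₂ : m₂ ≤ mΩ)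
    (h₃ : m₃ ≤ mΩ)
    (h : ∀ A B C, MeasurableSet[m₁] A → MeasurableSet[m₂] B → MeasurableSet[m₃] C →
      μ (A ∩ B ∩ C) = μ (A ∩ B) * μ C) : Indep (m₁ ⊔ m₂) m₃ μ := by
  set p : Set (Set Ω) := {D | ∃ A B, MeasurableSet[m₁] A ∧ MeasurableSet[m₂] B ∧ D = A ∩ B}
  have hp : IsPiSystem p := by
    rintro _ ⟨A, B, hA, hB, rfl⟩ _ ⟨A', B', hA', hB', rfl⟩ _
    exact ⟨A ∩ A', B ∩ B', hA.inter hA', hB.inter hB', Set.inter_inter_inter_comm _ _ _ _⟩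
  have hgen : m₁ ⊔ m₂ = MeasurableSpace.generateFrom p := by
    refine le_antisymm (sup_le ?_ ?_) (MeasurableSpace.generateFrom_le ?_)
    · exact fun A hA => MeasurableSpace.measurableSet_generateFrom
        ⟨A, Set.univ, hA, MeasurableSet.univ, (Set.inter_univ A).symm⟩
    · exact fun B hB => MeasurableSpace.measurableSet_generateFrom
        ⟨Set.univ, B, MeasurableSet.univ, hB, (Set.univ_inter B).symm⟩
    · rintro _ ⟨A, B, hA, hB, rfl⟩
      exact MeasurableSet.inter ((le_sup_left : m₁ ≤ m₁ ⊔ m₂) A hA)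
        ((le_sup_right : m₂ ≤ m₁ ⊔ m₂) B hB)
  refine IndepSets.indep (sup_le h₁ h₂) h₃ hp (@MeasurableSpace.isPiSystem_measurableSet Ω m₃)
    hgen (@MeasurableSpace.generateFrom_measurableSet Ω m₃).symm ?_
  rw [IndepSets_iff]
  rintro _ C ⟨A, B, hA, hB, rfl⟩ hC
  exact h A B C hA hB hC

/-- Two independent functions of a random variable `Y` that is independent of `m` are independent,
and also if `m` is joined to one of them. -/
lemma Indep.sup_comap_of_indepFun_map {Ω β γ γ' : Type*} {m mΩ : MeasurableSpace Ω}
    [MeasurableSpace β] [MeasurableSpace γ] [MeasurableSpace γ'] {μ : Measure Ω}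
    [IsProbabilityMeasure μ] (hm : m ≤ mΩ) {Y : Ω → β}
    (hY : Measurable Y) {f : β → γ} {g : β → γ'} (hf : Measurable f) (hg : Measurable g)
    (hmY : Indep m (MeasurableSpace.comap Y inferInstance) μ) (hfg : IndepFun f g (μ.map Y)) :
    Indep (m ⊔ MeasurableSpace.comap (fun ω => f (Y ω)) inferInstance)
      (MeasurableSpace.comap (fun ω => g (Y ω)) inferInstance) μ := by
  refine indep_sup_of_measure_inter hm (hf.comp hY).comap_le (hg.comp hY).comap_le ?_
  rintro A _ _ hA ⟨B, hB, rfl⟩ ⟨C, hC, rfl⟩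
  have hi := (Indep_iff _ _ _).1 hmY
  have e1 : (fun ω => f (Y ω)) ⁻¹' B = Y ⁻¹' (f ⁻¹' B) := rfl
  have e2 : (fun ω => g (Y ω)) ⁻¹' C = Y ⁻¹' (g ⁻¹' C) := rfl
  have h1 := hfg.measure_inter_preimage_eq_mul _ _ hB hC
  rw [Measure.map_apply hY ((hf hB).inter (hg hC)), Measure.map_apply hY (hf hB),
    Measure.map_apply hY (hg hC)] at h1
  rw [e1, e2, Set.inter_assoc, ← Set.preimage_inter,
    hi A _ hA ⟨_, (hf hB).inter (hg hC), rfl⟩, h1, hi A _ hA ⟨_, hf hB, rfl⟩, mul_assoc]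
lemma Measurable.apply_countable {Ω ι β : Type*} {mΩ : MeasurableSpace Ω}
    [MeasurableSpace ι] [Countable ι] [MeasurableSingletonClass ι] [MeasurableSpace β] {i : Ω → ι}
    (hi : Measurable i) {F : ι → Ω → β} (hF : ∀ i, Measurable (F i)) :
    Measurable fun ω => F (i ω) ω :=
  (measurable_from_prod_countable_right (f := fun x : ι × Ω => F x.1 x.2) hF).comp
    (hi.prodMk measurable_id)

lemma ENNReal.add_add_add_le_of_add_le {a b c d x y e f : ℝ≥0∞} (h₁ : a + x ≤ b + y)
    (h₂ : b + d + e ≤ c + f) : a + d + (e + x) ≤ c + (f + y) :=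
  calc a + d + (e + x) = a + x + (d + e) := by ring
    _ ≤ b + y + (d + e) := by gcongr
    _ = b + d + e + y := by ring
    _ ≤ c + f + y := by gcongr
    _ = c + (f + y) := by ring

/-! ### Concave log-likelihoods -/

section Analysis

open scoped RealInnerProductSpace

variable {E : Type*} [NormedAddCommGroup E] [InnerProductSpace ℝ E] [CompleteSpace E]

lemma concaveOn_le_add_inner_gradient {ℓ : E → ℝ} (hc : ConcaveOn ℝ Set.univ ℓ)
    (hd : Differentiable ℝ ℓ) (x y : E) : ℓ y ≤ ℓ x + ⟪gradient ℓ x, y - x⟫ := by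
  have hφ : ConcaveOn ℝ Set.univ (ℓ ∘ AffineMap.lineMap (k := ℝ) x y) := by
    simpa using hc.comp_affineMap (AffineMap.lineMap (k := ℝ) x y)
  have hder : HasDerivAt (ℓ ∘ AffineMap.lineMap (k := ℝ) x y) ⟪gradient ℓ x, y - x⟫ 0 := by
    have h1 : HasDerivAt (AffineMap.lineMap (k := ℝ) x y) (y - x) (0 : ℝ) :=
      AffineMap.hasDerivAt_lineMap
    have h2 : HasFDerivAt ℓ (fderiv ℝ ℓ x) (AffineMap.lineMap (k := ℝ) x y (0 : ℝ)) := by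
      simpa using (hd x).hasFDerivAt
    have h3 := h2.comp_hasDerivAt (0 : ℝ) h1
    rwa [← inner_gradient_left] at h3
  have := hφ.neg.le_slope_of_hasDerivAt (Set.mem_univ 0) (Set.mem_univ 1) one_pos hder.neg
  simp only [slope, Pi.neg_apply, Function.comp_apply, AffineMap.lineMap_apply_one,
    AffineMap.lineMap_apply_zero, sub_zero, inv_one, one_smul, vsub_eq_sub] at this
  linarith

/-- For a concave function with Lipschitz gradient, the first order expansion is a lower bound up
to a quadratic error: concavity bounds `ℓ x - ℓ (x + v)` with the gradient at `x + v`, which is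
within `L * ‖v‖` of the gradient at `x`. -/
lemma concaveOn_add_inner_gradient_sub_le {ℓ : E → ℝ} (hc : ConcaveOn ℝ Set.univ ℓ)
    (hd : Differentiable ℝ ℓ) {L : ℝ≥0} (hL : LipschitzWith L (gradient ℓ)) (x v : E) :
    ℓ x + ⟪gradient ℓ x, v⟫ - L * ‖v‖ ^ 2 ≤ ℓ (x + v) := by
  have h1 := concaveOn_le_add_inner_gradient hc hd (x + v) x
  have h2 : ‖gradient ℓ x - gradient ℓ (x + v)‖ ≤ L * ‖v‖ := by
    simpa using hL.norm_sub_le x (x + v)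
  have h3 : ⟪gradient ℓ x - gradient ℓ (x + v), v⟫ ≤ L * ‖v‖ ^ 2 := by
    refine (real_inner_le_norm _ _).trans ?_
    nlinarith [mul_le_mul_of_nonneg_right h2 (norm_nonneg v)]
  rw [sub_add_cancel_left, inner_neg_right] at h1
  rw [inner_sub_left] at h3
  linarith

lemma norm_gradient_le_of_lipschitzWith {ℓ : E → ℝ} {G : ℝ≥0} (hG : LipschitzWith G ℓ) (x : E) :
    ‖gradient ℓ x‖ ≤ G := by
  rw [gradient, LinearIsometryEquiv.norm_map]
  exact norm_fderiv_le_of_lipschitz ℝ hG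

end Analysis

lemma CoerciveLogLik.exists_isMax {d : ℕ} {ℓ : Params d → ℝ} (hc : Continuous ℓ)
    (h : CoerciveLogLik ℓ) : ∃ θ, ∀ θ', ℓ θ' ≤ ℓ θ := by
  obtain ⟨θ, hθ⟩ := hc.neg.exists_forall_le (β := Params d) h
  exact ⟨θ, fun θ' => by simpa using hθ θ'⟩

lemma ModelFamily.logLik_le_mle {M : Type*} [Fintype M] (𝓜 : ModelFamily M) {m : M}
    (hc : Continuous (𝓜.logLik m)) (h : CoerciveLogLik (𝓜.logLik m)) (θ : Params (𝓜.dim m)) :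
    𝓜.logLik m θ ≤ 𝓜.logLik m (𝓜.mle m) :=
  Classical.epsilon_spec (p := fun θ => ∀ θ', 𝓜.logLik m θ' ≤ 𝓜.logLik m θ) (h.exists_isMax hc) θ

/-- Away from the maximum the gradient is bounded below: near infinity by assumption, and on a
compact set because a concave function lies below its tangent hyperplanes. -/
lemma exists_le_norm_gradient {d : ℕ} {ℓ : Params d → ℝ} (hc : ConcaveOn ℝ Set.univ ℓ)
    (hd : Differentiable ℝ ℓ) (hf : AsymptoticallyFlatCond ℓ) (θs : Params d) {δ : ℝ}
    (hδ : 0 < δ) : ∃ c : ℝ, 0 < c ∧ ∀ θ, δ ≤ ℓ θs - ℓ θ → c ≤ ‖gradient ℓ θ‖ := by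
  obtain ⟨c₁, hc₁, h1⟩ := hf
  obtain ⟨K, hK, hK'⟩ := mem_cocompact.1 h1
  obtain ⟨D, hD⟩ := hK.isBounded.subset_closedBall θs
  have hD1 : 0 < |D| + 1 := by positivity
  refine ⟨min c₁ (δ / (|D| + 1)), lt_min hc₁ (by positivity), fun θ hθ => ?_⟩
  by_cases hθK : θ ∈ K
  · refine (min_le_right _ _).trans ?_
    rw [div_le_iff₀ hD1]
    have h2 := concaveOn_le_add_inner_gradient hc hd θ θs
    have h3 : ‖θs - θ‖ ≤ |D| + 1 := by
      have := hD hθK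
      rw [Metric.mem_closedBall, dist_comm, dist_eq_norm] at this
      linarith [le_abs_self D]
    have h4 := real_inner_le_norm (gradient ℓ θ) (θs - θ)
    nlinarith [mul_le_mul_of_nonneg_left h3 (norm_nonneg (gradient ℓ θ))]
  · refine (min_le_left _ _).trans ?_
    have h5 : c₁ ≤ ‖gradient (fun θ => -ℓ θ) θ‖ := hK' hθK
    have h6 : gradient (fun θ => -ℓ θ) θ = -gradient ℓ θ := by
      have h7 : fderiv ℝ (fun θ => -ℓ θ) θ = -fderiv ℝ ℓ θ := by simp
      rw [gradient, h7, map_neg, gradient]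
    rwa [h6, norm_neg] at h5

/-! ### One step of stochastic gradient ascent -/

lemma IsFirstOrderOracle.lintegral_norm_sq_le {W : Type*} [MeasurableSpace W] {ν : Measure W}
    [IsProbabilityMeasure ν] {d : ℕ} {ℓ : Params d → ℝ} {V : Params d → W → Params d} {q σ : ℝ}
    (h : IsFirstOrderOracle ν ℓ V q σ) (θ : Params d) :
    ∫⁻ w, ‖V θ w - gradient ℓ θ‖ₑ ^ 2 ∂ν ≤ ENNReal.ofReal (1 + σ ^ q) := by
  have h1 : ∀ x : ℝ≥0∞, x ^ 2 ≤ 1 + x ^ q := by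
    intro x
    rcases le_total x 1 with hx | hx
    · exact (pow_le_one₀ zero_le hx).trans le_self_add
    · refine le_trans ?_ le_add_self
      rw [← ENNReal.rpow_natCast]
      exact ENNReal.rpow_le_rpow_of_exponent_le hx (by simpa using h.two_le)
  calc ∫⁻ w, ‖V θ w - gradient ℓ θ‖ₑ ^ 2 ∂ν
      ≤ ∫⁻ w, (1 + ‖V θ w - gradient ℓ θ‖ₑ ^ q) ∂ν := lintegral_mono fun w => h1 _
    _ = 1 + ∫⁻ w, ‖V θ w - gradient ℓ θ‖ₑ ^ q ∂ν := by
      rw [lintegral_add_left measurable_const]; simp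
    _ ≤ 1 + ENNReal.ofReal (σ ^ q) := by gcongr; exact h.moment_le θ
    _ = ENNReal.ofReal (1 + σ ^ q) := by
      rw [ENNReal.ofReal_add zero_le_one (Real.rpow_nonneg h.sigma_nonneg _), ENNReal.ofReal_one]

/-- The expected effect of one step of stochastic gradient ascent: the gap `ℓ θs - ℓ` to the
maximum decreases by `a * ‖∇ ℓ‖ ^ 2`, up to an error of second order in the step size `a`. -/
lemma IsFirstOrderOracle.lintegral_gap_step_le {W : Type*} [MeasurableSpace W] {ν : Measure W}
    [IsProbabilityMeasure ν] {d : ℕ} {ℓ : Params d → ℝ} {V : Params d → W → Params d} {q σ : ℝ}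
    (h : IsFirstOrderOracle ν ℓ V q σ) (hc : ConcaveOn ℝ Set.univ ℓ) (hℓ : LipschitzLogLik ℓ)
    {θs : Params d} (hθs : ∀ θ, ℓ θ ≤ ℓ θs) :
    ∃ C : ℝ, 0 ≤ C ∧ ∀ (θ : Params d) (a : ℝ), 0 ≤ a →
      ∫⁻ w, ENNReal.ofReal (ℓ θs - ℓ (θ + a • V θ w)) ∂ν + ENNReal.ofReal (a * ‖gradient ℓ θ‖ ^ 2)
        ≤ ENNReal.ofReal (ℓ θs - ℓ θ) + ENNReal.ofReal (C * a ^ 2) := by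
  obtain ⟨hd, ⟨G, hG⟩, ⟨L, hL⟩⟩ := hℓ
  have hσ : 0 ≤ σ ^ q := Real.rpow_nonneg h.sigma_nonneg _
  refine ⟨2 * L * (G ^ 2 + (1 + σ ^ q)), by positivity, fun θ a ha => ?_⟩
  set g := gradient ℓ θ with hg
  set Z : W → Params d := fun w => V θ w - g with hZ
  have hZint : Integrable Z ν := h.integrable θ
  have hsq : ∫⁻ w, ‖Z w‖ₑ ^ 2 ∂ν ≤ ENNReal.ofReal (1 + σ ^ q) := h.lintegral_norm_sq_le θ
  have hsqe : ∀ w, ENNReal.ofReal (‖Z w‖ ^ 2) = ‖Z w‖ₑ ^ 2 := fun w => by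
    rw [ENNReal.ofReal_pow (norm_nonneg _), ofReal_norm]
  have hsqint : Integrable (fun w => ‖Z w‖ ^ 2) ν := by
    refine ⟨(hZint.aestronglyMeasurable.norm.pow 2), ?_⟩
    rw [hasFiniteIntegral_iff_ofReal (ae_of_all _ fun w => by positivity)]
    simp_rw [hsqe]
    exact hsq.trans_lt ENNReal.ofReal_lt_top
  have hsq' : ∫ w, ‖Z w‖ ^ 2 ∂ν ≤ 1 + σ ^ q := by
    rw [integral_eq_lintegral_of_nonneg_ae (ae_of_all _ fun w => by positivity)
      hsqint.aestronglyMeasurable]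
    simp_rw [hsqe]
    exact ENNReal.toReal_le_of_le_ofReal (by positivity) hsq
  have hgG : ‖g‖ ^ 2 ≤ G ^ 2 := by
    gcongr; exact norm_gradient_le_of_lipschitzWith hG θ
  set B : W → ℝ := fun w => ℓ θs - ℓ θ - a * ‖g‖ ^ 2 - a * inner ℝ g (Z w)
    + 2 * L * a ^ 2 * (‖g‖ ^ 2 + ‖Z w‖ ^ 2) with hB
  have hinner : Integrable (fun w => inner ℝ g (Z w)) ν := hZint.const_inner g
  have hBint : Integrable B ν :=
    (((integrable_const _).sub (hinner.const_mul a))).add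
      (((integrable_const _).add hsqint).const_mul _)
  have hpt : ∀ w, ℓ θs - ℓ (θ + a • V θ w) ≤ B w := by
    intro w
    have h1 := concaveOn_add_inner_gradient_sub_le hc hd hL θ (a • V θ w)
    have h2 : V θ w = g + Z w := by simp [hZ]
    have h3 : ‖g + Z w‖ ^ 2 ≤ 2 * (‖g‖ ^ 2 + ‖Z w‖ ^ 2) := by
      have := norm_add_le g (Z w)
      nlinarith [norm_nonneg (g + Z w), sq_nonneg (‖g‖ - ‖Z w‖)]
    rw [← hg, inner_smul_right, norm_smul, h2, inner_add_right, real_inner_self_eq_norm_sq,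
      mul_pow, Real.norm_eq_abs, sq_abs] at h1
    have h4 : L * (a ^ 2 * ‖g + Z w‖ ^ 2) ≤ L * (a ^ 2 * (2 * (‖g‖ ^ 2 + ‖Z w‖ ^ 2))) := by
      gcongr
    rw [h2]
    simp only [hB]
    linarith
  have hBval : ∫ w, B w ∂ν = ℓ θs - ℓ θ - a * ‖g‖ ^ 2
      + 2 * L * a ^ 2 * (‖g‖ ^ 2 + ∫ w, ‖Z w‖ ^ 2 ∂ν) := by
    have hz : ∫ w, inner ℝ g (Z w) ∂ν = 0 := by
      rw [integral_inner hZint g, show ∫ w, Z w ∂ν = 0 from h.mean_zero θ, inner_zero_right]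
    simp only [hB]
    have i1 : Integrable (fun w => a * inner ℝ g (Z w)) ν := hinner.const_mul a
    have i2 : Integrable (fun w => ‖g‖ ^ 2 + ‖Z w‖ ^ 2) ν := (integrable_const _).add hsqint
    have i3 : Integrable (fun w => 2 * L * a ^ 2 * (‖g‖ ^ 2 + ‖Z w‖ ^ 2)) ν := i2.const_mul _
    have i4 : Integrable (fun w => ℓ θs - ℓ θ - a * ‖g‖ ^ 2 - a * inner ℝ g (Z w)) ν :=
      (integrable_const _).sub i1
    rw [integral_add i4 i3, integral_sub (integrable_const _) i1, integral_const_mul,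
      integral_const_mul, hz, integral_add (integrable_const _) hsqint]
    simp
  have hB0 : ∀ w, 0 ≤ B w := fun w => (sub_nonneg.2 (hθs _)).trans (hpt w)
  calc ∫⁻ w, ENNReal.ofReal (ℓ θs - ℓ (θ + a • V θ w)) ∂ν + ENNReal.ofReal (a * ‖g‖ ^ 2)
      ≤ ∫⁻ w, ENNReal.ofReal (B w) ∂ν + ENNReal.ofReal (a * ‖g‖ ^ 2) := by
        gcongr with w; exact hpt w
    _ = ENNReal.ofReal (∫ w, B w ∂ν + a * ‖g‖ ^ 2) := by
        rw [← ofReal_integral_eq_lintegral_ofReal hBint (ae_of_all _ hB0),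
          ENNReal.ofReal_add (integral_nonneg hB0) (by positivity)]
    _ ≤ ENNReal.ofReal (ℓ θs - ℓ θ + 2 * L * (G ^ 2 + (1 + σ ^ q)) * a ^ 2) := by
        apply ENNReal.ofReal_le_ofReal
        rw [hBval]
        have : 2 * L * a ^ 2 * (‖g‖ ^ 2 + ∫ w, ‖Z w‖ ^ 2 ∂ν)
            ≤ 2 * L * a ^ 2 * (G ^ 2 + (1 + σ ^ q)) := by gcongr
        linarith
    _ = _ := ENNReal.ofReal_add (sub_nonneg.2 (hθs _)) (by positivity)

lemma setLIntegral_oracle_step_le {Ω W E : Type*} {m mΩ : MeasurableSpace Ω}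
    [MeasurableSpace W] {μ : Measure Ω} [IsProbabilityMeasure μ] {ν : Measure W}
    [NormedAddCommGroup E] [NormedSpace ℝ E] [MeasurableSpace E] [BorelSpace E]
    [SecondCountableTopology E] (hm : m ≤ mΩ) {f : E → ℝ≥0∞} (hf : Measurable f)
    {V : E → W → E} (hV : Measurable (Function.uncurry V)) {θ : Ω → E} (hθ : Measurable[m] θ)
    {a : Ω → ℝ} (ha : Measurable[m] a) (ha0 : ∀ ω, 0 ≤ a ω) {w : Ω → W} (hw : Measurable[mΩ] w)
    (hi : Indep m (MeasurableSpace.comap w inferInstance) μ) (hν : μ.map w = ν) {g : E → ℝ} {C : ℝ}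
    (hC : ∀ (θ : E) (a : ℝ), 0 ≤ a →
      ∫⁻ w, f (θ + a • V θ w) ∂ν + ENNReal.ofReal (a * g θ) ≤ f θ + ENNReal.ofReal (C * a ^ 2))
    {D : Set Ω} (hD : MeasurableSet[m] D) :
    ∫⁻ ω in D, f (θ ω + a ω • V (θ ω) (w ω)) ∂μ + ∫⁻ ω in D, ENNReal.ofReal (a ω * g (θ ω)) ∂μ
      ≤ ∫⁻ ω in D, f (θ ω) ∂μ + ∫⁻ ω in D, ENNReal.ofReal (C * a ω ^ 2) ∂μ := by
  have hF : Measurable fun x : (E × ℝ) × W => f (x.1.1 + x.1.2 • V x.1.1 x.2) := by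
    have h1 : Measurable fun x : (E × ℝ) × W => V x.1.1 x.2 :=
      hV.comp (measurable_fst.fst.prodMk measurable_snd)
    exact hf.comp (measurable_fst.fst.add (measurable_fst.snd.smul h1))
  have := Measure.isProbabilityMeasure_map (μ := μ) hw.aemeasurable
  have hm1 : Measurable fun ω => ∫⁻ x, f (θ ω + a ω • V (θ ω) x) ∂μ.map w :=
    hF.lintegral_prod_right'.comp ((hθ.prodMk ha).mono hm le_rfl)
  have key := setLIntegral_comp_of_indep hm (hθ.prodMk ha) hw hi hF hD
  simp only at key
  subst hν
  have hm2 : Measurable fun ω => f (θ ω) := hf.comp (hθ.mono hm le_rfl)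
  rw [key, ← lintegral_add_left hm1, ← lintegral_add_left hm2]
  exact lintegral_mono fun ω => hC (θ ω) (a ω) (ha0 ω)

/-! ### Step sizes -/

/-- Step sizes of order `τ ^ (-l)` with `0 < l ≤ 1` are small, are bounded below by a multiple of
the divergent series `1 / τ`, and eventually the squares of `U` successive step sizes are
negligible compared to the first of them. -/
lemma IsStepSize.exists_forall_ge {a : ℕ → ℝ} {l : ℝ} (h : IsStepSize a l) (hl0 : 0 < l)
    (hl1 : l ≤ 1) (U : ℕ) {b : ℝ} (hb : 0 < b) {C : ℝ} (hC : 0 ≤ C) :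
    ∃ (T : ℕ) (κ : ℝ), 0 < κ ∧ ∀ τ, T ≤ τ →
      ∑ k ∈ Finset.range U, C * a (τ + k + 1) ^ 2 ≤ b * a (τ + 1) ∧ κ / (τ + 1) ≤ a (τ + 1) ∧
        a (τ + 1) ≤ 1 := by
  obtain ⟨hpos, hΘ⟩ := h
  obtain ⟨c₁, hc₁, h1⟩ := hΘ.1.exists_pos
  obtain ⟨c₂, hc₂, h2⟩ := hΘ.2.exists_pos
  have hpow : Tendsto (fun n : ℕ => (n : ℝ) ^ l) atTop atTop :=
    (tendsto_rpow_atTop hl0).comp tendsto_natCast_atTop_atTop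
  have h3 : ∀ᶠ n : ℕ in atTop, c₁ + C * U * c₁ ^ 2 * c₂ / b ≤ (n : ℝ) ^ l :=
    hpow.eventually_ge_atTop _
  obtain ⟨T, hT⟩ := eventually_atTop.1 (h1.bound.and (h2.bound.and h3))
  have key : ∀ n, T ≤ n → 1 ≤ n → a n ≤ c₁ / (n : ℝ) ^ l ∧ 1 / (n : ℝ) ^ l ≤ c₂ * a n := by
    intro n hn hn1
    obtain ⟨h4, h5, -⟩ := hT n hn
    have hnl : 0 ≤ 1 / (n : ℝ) ^ l := by positivity
    rw [Real.norm_of_nonneg (hpos n hn1).le, Real.norm_of_nonneg hnl] at h4 h5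
    exact ⟨by rw [div_eq_mul_one_div]; exact h4, h5⟩
  refine ⟨T, 1 / c₂, by positivity, fun τ hτ => ?_⟩
  obtain ⟨k1, k2⟩ := key (τ + 1) (by omega) (by omega)
  obtain ⟨-, -, h6⟩ := hT (τ + 1) (by omega)
  have hp : (0 : ℝ) < ((τ + 1 : ℕ) : ℝ) ^ l := by positivity
  have hq : 0 ≤ C * U * c₁ ^ 2 * c₂ / b := by positivity
  have hX : C * U * c₁ ^ 2 * c₂ / b ≤ ((τ + 1 : ℕ) : ℝ) ^ l := by linarith
  have hX' : c₁ ≤ ((τ + 1 : ℕ) : ℝ) ^ l := by linarith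
  refine ⟨?_, ?_, k1.trans ((div_le_one hp).2 hX')⟩
  · have hterm : ∀ k ∈ Finset.range U,
        C * a (τ + k + 1) ^ 2 ≤ C * (c₁ / ((τ + 1 : ℕ) : ℝ) ^ l) ^ 2 := by
      intro k _
      have h7 := (key (τ + k + 1) (by omega) (by omega)).1
      have h8 : c₁ / ((τ + k + 1 : ℕ) : ℝ) ^ l ≤ c₁ / ((τ + 1 : ℕ) : ℝ) ^ l := by
        gcongr; omega
      have h9 := (hpos (τ + k + 1) (by omega)).le
      gcongr
      exact h7.trans h8
    refine (Finset.sum_le_card_nsmul _ _ _ hterm).trans ?_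
    rw [Finset.card_range, nsmul_eq_mul]
    set x := ((τ + 1 : ℕ) : ℝ) ^ l
    rw [div_le_iff₀ hb] at hX
    have h10 : b * (1 / x / c₂) ≤ b * a (τ + 1) := by
      gcongr
      rw [div_le_iff₀ hc₂]; linarith
    refine le_trans ?_ h10
    have e1 : (U : ℝ) * (C * (c₁ / x) ^ 2) = (C * U * c₁ ^ 2 * c₂) / (x * x * c₂) := by
      field_simp
    have e2 : b * (1 / x / c₂) = (x * b) / (x * x * c₂) := by
      field_simp
    rw [e1, e2]
    gcongr
  · have h11 : ((τ + 1 : ℕ) : ℝ) ^ l ≤ τ + 1 := by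
      push_cast
      have : (1 : ℝ) ≤ τ + 1 := by linarith [(Nat.cast_nonneg τ : (0 : ℝ) ≤ τ)]
      simpa using Real.rpow_le_rpow_of_exponent_le this hl1
    have h12 : 1 / ((τ : ℝ) + 1) ≤ 1 / ((τ + 1 : ℕ) : ℝ) ^ l := by gcongr
    rw [div_div, mul_comm, ← div_div, div_le_iff₀ hc₂]
    linarith

/-! ### A law of large numbers for bounded martingale differences -/

section LawOfLargeNumbers

variable {Ω : Type*} {mΩ : MeasurableSpace Ω} {μ : Measure Ω} [IsProbabilityMeasure μ]
  {ℱ : Filtration ℕ mΩ} {D : ℕ → Ω → ℝ}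

/-- The increments are orthogonal in `L²`. -/
lemma integral_sq_sum_le_of_condExp_eq_zero (hD : ∀ s, StronglyMeasurable[ℱ (s + 1)] (D s))
    (hbound : ∀ s ω, |D s ω| ≤ 1) (hcond : ∀ s, μ[D s | ℱ s] =ᵐ[μ] 0) (t : ℕ) :
    ∫ ω, (∑ s ∈ Finset.range t, D s ω) ^ 2 ∂μ ≤ t := by
  have hDm : ∀ s, StronglyMeasurable (D s) := fun s => (hD s).mono (ℱ.le _)
  have hDint : ∀ s, Integrable (D s) μ := fun s =>
    Integrable.of_bound (hDm s).aestronglyMeasurable 1 (ae_of_all _ fun ω => hbound s ω)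
  have hSb : ∀ t ω, |∑ s ∈ Finset.range t, D s ω| ≤ t := by
    intro t ω
    refine (Finset.abs_sum_le_sum_abs _ _).trans ?_
    simpa using Finset.sum_le_card_nsmul (Finset.range t) _ 1 fun s _ => hbound s ω
  have hSm : ∀ t, StronglyMeasurable[ℱ t] fun ω => ∑ s ∈ Finset.range t, D s ω := fun t =>
    Finset.stronglyMeasurable_fun_sum _ fun s hs =>
      (hD s).mono (ℱ.mono (Nat.succ_le_of_lt (Finset.mem_range.1 hs)))
  induction t with
  | zero => simp
  | succ t ih =>
    have hSm' := (hSm t).mono (ℱ.le t)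
    have hS2 : Integrable (fun ω => (∑ s ∈ Finset.range t, D s ω) ^ 2) μ := by
      refine Integrable.of_bound (hSm'.pow 2).aestronglyMeasurable ((t : ℝ) ^ 2)
        (ae_of_all _ fun ω => ?_)
      rw [norm_pow, Real.norm_eq_abs]
      gcongr
      exact hSb t ω
    have hSD : Integrable (fun ω => (∑ s ∈ Finset.range t, D s ω) * D t ω) μ := by
      refine (hDint t).bdd_mul hSm'.aestronglyMeasurable (c := t)
        (ae_of_all _ fun ω => hSb t ω)
    have hD2 : Integrable (fun ω => D t ω ^ 2) μ := by
      refine Integrable.of_bound ((hDm t).pow 2).aestronglyMeasurable 1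
        (ae_of_all _ fun ω => ?_)
      rw [norm_pow, Real.norm_eq_abs]
      exact pow_le_one₀ (abs_nonneg _) (hbound t ω)
    have hzero : ∫ ω, (∑ s ∈ Finset.range t, D s ω) * D t ω ∂μ = 0 := by
      have h1 : μ[(fun ω => ∑ s ∈ Finset.range t, D s ω) * D t | ℱ t] =ᵐ[μ]
          (fun ω => ∑ s ∈ Finset.range t, D s ω) * μ[D t | ℱ t] :=
        condExp_mul_of_stronglyMeasurable_left (hSm t) hSD (hDint t)
      have h2 := integral_condExp (μ := μ) (ℱ.le t)
        (f := (fun ω => ∑ s ∈ Finset.range t, D s ω) * D t)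
      rw [show ∫ ω, (∑ s ∈ Finset.range t, D s ω) * D t ω ∂μ
        = ∫ ω, ((fun ω => ∑ s ∈ Finset.range t, D s ω) * D t) ω ∂μ from rfl, ← h2,
        integral_congr_ae h1]
      refine integral_eq_zero_of_ae ?_
      filter_upwards [hcond t] with ω hω
      simp [hω]
    have hD1 : ∫ ω, D t ω ^ 2 ∂μ ≤ 1 := by
      calc ∫ ω, D t ω ^ 2 ∂μ ≤ ∫ _, (1 : ℝ) ∂μ := by
            refine integral_mono hD2 (integrable_const _) fun ω => ?_
            exact (sq_le_one_iff_abs_le_one _).2 (hbound t ω)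
        _ = 1 := by simp
    calc ∫ ω, (∑ s ∈ Finset.range (t + 1), D s ω) ^ 2 ∂μ
        = ∫ ω, ((∑ s ∈ Finset.range t, D s ω) ^ 2
          + 2 * ((∑ s ∈ Finset.range t, D s ω) * D t ω) + D t ω ^ 2) ∂μ := by
          congr with ω
          rw [Finset.sum_range_succ]; ring
      _ = ∫ ω, (∑ s ∈ Finset.range t, D s ω) ^ 2 ∂μ + ∫ ω, D t ω ^ 2 ∂μ := by
          have i1 : Integrable (fun ω => (∑ s ∈ Finset.range t, D s ω) ^ 2
            + 2 * ((∑ s ∈ Finset.range t, D s ω) * D t ω)) μ := hS2.add (hSD.const_mul 2)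
          rw [integral_add i1 hD2, integral_add hS2 (hSD.const_mul 2),
            integral_const_mul, hzero, mul_zero, add_zero]
      _ ≤ t + 1 := add_le_add ih hD1
      _ = ((t + 1 : ℕ) : ℝ) := by push_cast; ring

/-- The averages converge along the squares by the first Borel–Cantelli lemma, and between
successive squares the sum changes too little to matter. -/
lemma ae_tendsto_average_zero (hD : ∀ s, StronglyMeasurable[ℱ (s + 1)] (D s))
    (hbound : ∀ s ω, |D s ω| ≤ 1) (hcond : ∀ s, μ[D s | ℱ s] =ᵐ[μ] 0) :
    ∀ᵐ ω ∂μ, Tendsto (fun t : ℕ => (t : ℝ)⁻¹ * ∑ s ∈ Finset.range t, D s ω) atTop (𝓝 0) := by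
  have hDm : ∀ s, Measurable (D s) := fun s => ((hD s).mono (ℱ.le _)).measurable
  set S : ℕ → Ω → ℝ := fun t ω => ∑ s ∈ Finset.range t, D s ω with hS
  have hSm : ∀ t, Measurable (S t) := fun t => Finset.measurable_fun_sum _ fun s _ => hDm s
  have hSb : ∀ t ω, |S t ω| ≤ t := by
    intro t ω
    refine (Finset.abs_sum_le_sum_abs _ _).trans ?_
    simpa using Finset.sum_le_card_nsmul (Finset.range t) _ 1 fun s _ => hbound s ω
  set Y : ℕ → Ω → ℝ := fun n ω => (S ((n + 1) ^ 2) ω / ((n : ℝ) + 1) ^ 2) ^ 2 with hY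
  have hYm : ∀ n, Measurable (Y n) := fun n => ((hSm _).div_const _).pow_const 2
  have hYint : ∀ n, ∫⁻ ω, ENNReal.ofReal (Y n ω) ∂μ
      ≤ ENNReal.ofReal (1 / ((n : ℝ) + 1) ^ 2) := by
    intro n
    have hn : (0 : ℝ) < (n : ℝ) + 1 := by positivity
    have hi : Integrable (Y n) μ := by
      refine Integrable.of_bound (hYm n).aestronglyMeasurable 1 (ae_of_all _ fun ω => ?_)
      rw [hY, norm_pow, norm_div, Real.norm_eq_abs, Real.norm_of_nonneg (by positivity)]
      refine pow_le_one₀ (by positivity) ((div_le_one (by positivity)).2 ?_)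
      exact_mod_cast hSb ((n + 1) ^ 2) ω
    rw [← ofReal_integral_eq_lintegral_ofReal hi (ae_of_all _ fun ω => sq_nonneg _)]
    refine ENNReal.ofReal_le_ofReal ?_
    have h1 := integral_sq_sum_le_of_condExp_eq_zero hD hbound hcond ((n + 1) ^ 2)
    simp only [hY, div_pow, integral_div]
    rw [div_le_div_iff₀ (by positivity) (by positivity), one_mul]
    push_cast at h1
    calc (∫ ω, S ((n + 1) ^ 2) ω ^ 2 ∂μ) * ((n : ℝ) + 1) ^ 2
        ≤ ((n : ℝ) + 1) ^ 2 * ((n : ℝ) + 1) ^ 2 := by gcongr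
      _ = _ := by ring
  have hsummable : Summable fun n : ℕ => 1 / ((n : ℝ) + 1) ^ 2 := by
    have := (summable_nat_add_iff 1).2 (Real.summable_one_div_nat_pow.2 (one_lt_two))
    simpa using this
  have hfin : ∫⁻ ω, ∑' n, ENNReal.ofReal (Y n ω) ∂μ ≠ ∞ := by
    rw [lintegral_tsum fun n => (hYm n).ennreal_ofReal.aemeasurable]
    refine ne_top_of_le_ne_top ?_ (ENNReal.tsum_le_tsum hYint)
    rw [← ENNReal.ofReal_tsum_of_nonneg (fun n => by positivity) hsummable]
    exact ENNReal.ofReal_ne_top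
  filter_upwards [ae_lt_top (Measurable.tsum fun n => (hYm n).ennreal_ofReal) hfin]
    with ω hω
  have h1 : Tendsto (fun n => Y n ω) atTop (𝓝 0) := by
    have h2 := ENNReal.tendsto_atTop_zero_of_tsum_ne_top hω.ne
    have h3 := (ENNReal.tendsto_toReal ENNReal.zero_ne_top).comp h2
    rw [ENNReal.toReal_zero] at h3
    exact h3.congr fun n => ENNReal.toReal_ofReal (sq_nonneg _)
  have h4 : Tendsto (fun n : ℕ => |S ((n + 1) ^ 2) ω| / ((n : ℝ) + 1) ^ 2) atTop (𝓝 0) := by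
    have := (Real.continuous_sqrt.tendsto 0).comp h1
    rw [Real.sqrt_zero] at this
    refine this.congr fun n => ?_
    simp only [Function.comp_apply, hY]
    rw [Real.sqrt_sq_eq_abs, abs_div, abs_of_nonneg (by positivity : (0 : ℝ) ≤ ((n : ℝ) + 1) ^ 2)]
  have h5 : Tendsto (fun n : ℕ => |S ((n + 1) ^ 2) ω| / ((n : ℝ) + 1) ^ 2
      + 2 * (1 / ((n : ℝ) + 1))) atTop (𝓝 0) := by
    simpa using h4.add (tendsto_one_div_add_atTop_nhds_zero_nat.const_mul 2)
  have hsqrt : Tendsto (fun t : ℕ => t.sqrt - 1) atTop atTop := by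
    refine tendsto_atTop.2 fun b => ?_
    filter_upwards [eventually_ge_atTop ((b + 1) * (b + 1))] with t ht
    have := Nat.le_sqrt.2 ht
    omega
  refine squeeze_zero_norm' ?_ (h5.comp hsqrt)
  filter_upwards [eventually_ge_atTop 1] with t ht
  -- Compare with the last square `r ^ 2` before `t`.
  set r := t.sqrt with hr
  have hr1 : 1 ≤ r := Nat.le_sqrt.2 (by simpa using ht)
  have hrt : r ^ 2 ≤ t := by rw [pow_two]; exact Nat.sqrt_le t
  have hrt' : t ≤ r ^ 2 + 2 * r := by rw [pow_two, two_mul, ← add_assoc]; exact Nat.sqrt_le_add t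
  have hS1 : |S t ω| ≤ |S (r ^ 2) ω| + 2 * r := by
    have e : S t ω = S (r ^ 2) ω + ∑ s ∈ Finset.Ico (r ^ 2) t, D s ω :=
      (Finset.sum_range_add_sum_Ico _ hrt).symm
    have h6 : |∑ s ∈ Finset.Ico (r ^ 2) t, D s ω| ≤ 2 * r := by
      refine (Finset.abs_sum_le_sum_abs _ _).trans ?_
      refine (Finset.sum_le_card_nsmul _ _ 1 fun s _ => hbound s ω).trans ?_
      rw [Nat.card_Ico, nsmul_eq_mul, mul_one]
      have : t - r ^ 2 ≤ 2 * r := by omega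
      exact_mod_cast this
    rw [e]
    exact (abs_add_le _ _).trans (by linarith)
  have hrr : ((r - 1 : ℕ) : ℝ) + 1 = r := by
    rw [Nat.cast_sub hr1]; simp
  have hr0 : (0 : ℝ) < r := by exact_mod_cast hr1
  simp only [Function.comp_apply]
  rw [hrr, Nat.sub_add_cancel hr1, norm_mul, norm_inv, Real.norm_natCast, Real.norm_eq_abs]
  have hrt2 : (r : ℝ) ^ 2 ≤ t := by exact_mod_cast hrt
  calc (t : ℝ)⁻¹ * |S t ω| ≤ ((r : ℝ) ^ 2)⁻¹ * (|S (r ^ 2) ω| + 2 * r) := by gcongr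
    _ = _ := by field_simp

end LawOfLargeNumbers

/-- Averages of a sequence that is eventually dominated, for every `k`, by a sequence whose
averages are asymptotically at most `2 / (k + 1)`. -/
lemma tendsto_average_zero_of_dominated {a : ℕ → ℝ} {b p : ℕ → ℕ → ℝ} (ha : ∀ s, |a s| ≤ 1)
    (hb0 : ∀ k s, 0 ≤ b k s) (hp : ∀ k s, p k s ≤ 2 * (1 / ((k : ℝ) + 1)))
    (hab : ∀ k, ∀ᶠ s in atTop, |a s| ≤ b k s)
    (h : ∀ k, Tendsto (fun t : ℕ => (t : ℝ)⁻¹ * ∑ s ∈ Finset.range t, (b k s - p k s)) atTop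
      (𝓝 0)) :
    Tendsto (fun t : ℕ => (t : ℝ)⁻¹ * ∑ s ∈ Finset.range t, a s) atTop (𝓝 0) := by
  rw [Metric.tendsto_atTop']
  intro ρ hρ
  obtain ⟨k, hk⟩ := ((tendsto_one_div_add_atTop_nhds_zero_nat.const_mul (2 : ℝ)).eventually_lt_const
    (by simpa using half_pos hρ : (2 : ℝ) * 0 < ρ / 2)).exists
  obtain ⟨N, hN⟩ := eventually_atTop.1 (hab k)
  have h1 : Tendsto (fun t : ℕ => (t : ℝ)⁻¹ * N + (t : ℝ)⁻¹ * ∑ s ∈ Finset.range t,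
      (b k s - p k s)) atTop (𝓝 0) := by
    simpa using ((tendsto_inv_atTop_nhds_zero_nat (𝕜 := ℝ)).mul_const (N : ℝ)).add (h k)
  obtain ⟨t₀, ht₀⟩ := eventually_atTop.1 (h1.eventually_lt_const (half_pos hρ))
  refine ⟨max t₀ 1, fun t ht => ?_⟩
  have ht1 : t₀ ≤ t := (le_max_left _ _).trans ht.le
  have htpos : (0 : ℝ) < t := by exact_mod_cast (le_max_right t₀ 1).trans_lt ht |>.trans' one_pos
  rw [dist_zero_right, norm_mul, norm_inv, Real.norm_natCast, Real.norm_eq_abs]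
  have hsum : |∑ s ∈ Finset.range t, a s| ≤ N + (∑ s ∈ Finset.range t, (b k s - p k s)
      + t * (2 * (1 / ((k : ℝ) + 1)))) := by
    have h2 : ∀ s, |a s| ≤ (if s < N then 1 else 0) + ((b k s - p k s)
        + 2 * (1 / ((k : ℝ) + 1))) := by
      intro s
      have := hp k s
      have := hb0 k s
      split_ifs with hs
      · linarith [ha s]
      · linarith [hN s (not_lt.1 hs)]
    have h3 : ∑ s ∈ Finset.range t, (if s < N then (1 : ℝ) else 0) ≤ N := by
      rw [← Finset.sum_filter, Finset.sum_const, nsmul_eq_mul, mul_one]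
      have : (Finset.range t).filter (· < N) ⊆ Finset.range N := fun s hs => by
        simpa using (Finset.mem_filter.1 hs).2
      exact_mod_cast (Finset.card_le_card this).trans (Finset.card_range N).le
    refine (Finset.abs_sum_le_sum_abs _ _).trans ((Finset.sum_le_sum fun s _ => h2 s).trans ?_)
    rw [Finset.sum_add_distrib, Finset.sum_add_distrib, Finset.sum_const, Finset.card_range,
      nsmul_eq_mul]
    gcongr
  calc (t : ℝ)⁻¹ * |∑ s ∈ Finset.range t, a s|
      ≤ (t : ℝ)⁻¹ * (N + (∑ s ∈ Finset.range t, (b k s - p k s)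
        + t * (2 * (1 / ((k : ℝ) + 1))))) := by gcongr
    _ = ((t : ℝ)⁻¹ * N + (t : ℝ)⁻¹ * ∑ s ∈ Finset.range t, (b k s - p k s))
        + 2 * (1 / ((k : ℝ) + 1)) := by
      rw [mul_add, mul_add, inv_mul_cancel_left₀ htpos.ne', add_assoc]
    _ < ρ / 2 + ρ / 2 := add_lt_add (ht₀ t ht1) hk
    _ = ρ := add_halves ρ

/-! ### Empirical frequencies and reversible Markov chains -/

/-- A distribution `f` on a finite set that is almost invariant for a reversible transition matrix
with positive off-diagonal entries is close to the reversing distribution. With `h = f / ϖ` the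
defect of invariance is `∑ P m m' (h m - h m')` at `m`; at a maximum of `h` all terms are
nonnegative, so that the oscillation of `h` is controlled. -/
lemma abs_sub_le_of_reversible {M : Type*} [Fintype M] {P : M → M → ℝ}
    {ϖ : M → ℝ} {c : ℝ} (hc : 0 < c) (hP0 : ∀ m m', 0 ≤ P m m') (hP : ∀ m, ∑ m', P m m' = 1)
    (hPc : ∀ m m', m ≠ m' → c ≤ P m m') (hϖ : ∀ m, 0 < ϖ m) (hϖ1 : ∑ m, ϖ m = 1)
    (hrev : ∀ m m', ϖ m * P m m' = ϖ m' * P m' m) {f : M → ℝ} (hf : ∑ m, f m = 1) (m : M) :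
    |f m - ϖ m| ≤ c⁻¹ * ∑ m', |f m' - ∑ k, f k * P k m'| / ϖ m' := by
  have : Nonempty M := ⟨m⟩
  set h : M → ℝ := fun m => f m / ϖ m with hh
  have hfh : ∀ m, f m = ϖ m * h m := fun m => by
    simp only [hh]; rw [mul_div_cancel₀ _ (hϖ m).ne']
  have hdef : ∀ m', (f m' - ∑ k, f k * P k m') / ϖ m' = ∑ k, P m' k * (h m' - h k) := by
    intro m'
    have h1 : ∑ k, f k * P k m' = ϖ m' * ∑ k, P m' k * h k := by
      rw [Finset.mul_sum]
      refine Finset.sum_congr rfl fun k _ => ?_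
      rw [hfh k, mul_right_comm, hrev k m', mul_assoc]
    rw [h1, hfh m', ← mul_sub, mul_div_cancel_left₀ _ (hϖ m').ne']
    simp_rw [mul_sub, Finset.sum_sub_distrib, ← Finset.sum_mul, hP, one_mul]
  obtain ⟨a, ha⟩ := Finite.exists_max h
  set b := ∑ m', |f m' - ∑ k, f k * P k m'| / ϖ m' with hb
  have hb0 : ∀ m', 0 ≤ |f m' - ∑ k, f k * P k m'| / ϖ m' := fun m' =>
    div_nonneg (abs_nonneg _) (hϖ m').le
  have hosc : ∀ k, h a - h k ≤ c⁻¹ * b := by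
    intro k
    rw [← div_eq_inv_mul, le_div_iff₀ hc]
    by_cases hk : k = a
    · rw [hk, sub_self, zero_mul]
      exact Finset.sum_nonneg fun m' _ => hb0 m'
    · calc (h a - h k) * c ≤ P a k * (h a - h k) := by
            rw [mul_comm]
            exact mul_le_mul_of_nonneg_right (hPc a k (Ne.symm hk)) (sub_nonneg.2 (ha k))
        _ ≤ ∑ k, P a k * (h a - h k) :=
            Finset.single_le_sum (f := fun k => P a k * (h a - h k))
              (fun k _ => mul_nonneg (hP0 a k) (sub_nonneg.2 (ha k))) (Finset.mem_univ k)
        _ = (f a - ∑ k, f k * P k a) / ϖ a := (hdef a).symm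
        _ ≤ |f a - ∑ k, f k * P k a| / ϖ a := by
            gcongr
            · exact (hϖ a).le
            · exact le_abs_self _
        _ ≤ b := Finset.single_le_sum (f := fun m' => |f m' - ∑ k, f k * P k m'| / ϖ m')
            (fun m' _ => hb0 m') (Finset.mem_univ a)
  have hmean : ∑ k, ϖ k * h k = 1 := by simp_rw [← hfh, hf]
  have h1a : 1 ≤ h a := by
    calc 1 = ∑ k, ϖ k * h k := hmean.symm
      _ ≤ ∑ k, ϖ k * h a := Finset.sum_le_sum fun k _ =>
          mul_le_mul_of_nonneg_left (ha k) (hϖ k).le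
      _ = h a := by rw [← Finset.sum_mul, hϖ1, one_mul]
  have ha1 : h a - 1 ≤ c⁻¹ * b := by
    calc h a - 1 = ∑ k, ϖ k * (h a - h k) := by
          simp_rw [mul_sub, Finset.sum_sub_distrib, ← Finset.sum_mul, hϖ1, hmean, one_mul]
      _ ≤ ∑ k, ϖ k * (c⁻¹ * b) := Finset.sum_le_sum fun k _ =>
          mul_le_mul_of_nonneg_left (hosc k) (hϖ k).le
      _ = _ := by rw [← Finset.sum_mul, hϖ1, one_mul]
  have hm1 : |h m - 1| ≤ c⁻¹ * b := abs_le.2 ⟨by linarith [hosc m], by linarith [ha m]⟩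
  have hϖle : ϖ m ≤ 1 := by
    rw [← hϖ1]
    exact Finset.single_le_sum (fun k _ => (hϖ k).le) (Finset.mem_univ m)
  calc |f m - ϖ m| = ϖ m * |h m - 1| := by
        rw [hfh m, ← mul_sub_one, abs_mul, abs_of_pos (hϖ m)]
    _ ≤ 1 * |h m - 1| := by gcongr
    _ ≤ _ := by rwa [one_mul]

/-- If the successors of the visits to the states are distributed in the long run according to the
transition matrix, then the frequencies of the states are asymptotically invariant. -/
lemma tendsto_mcEstimate_of_reversible {M : Type*} [Fintype M] [DecidableEq M] {P : M → M → ℝ}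
    {ϖ : M → ℝ} {c : ℝ} (hc : 0 < c) (hP0 : ∀ m m', 0 ≤ P m m') (hP : ∀ m, ∑ m', P m m' = 1)
    (hPc : ∀ m m', m ≠ m' → c ≤ P m m') (hϖ : ∀ m, 0 < ϖ m) (hϖ1 : ∑ m, ϖ m = 1)
    (hrev : ∀ m m', ϖ m * P m m' = ϖ m' * P m' m) {X : ℕ → M}
    (hX : ∀ m', Tendsto (fun t : ℕ => (t : ℝ)⁻¹ * ∑ s ∈ Finset.range t,
      ((if X (s + 1) = m' then 1 else 0) - P (X s) m')) atTop (𝓝 0)) (m : M) :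
    Tendsto (fun t => mcEstimate X t m) atTop (𝓝 (ϖ m)) := by
  set f : ℕ → M → ℝ := fun t m => (t : ℝ)⁻¹ * ∑ s ∈ Finset.range t, if X s = m then 1 else 0
    with hf
  have hmc : ∀ t m, mcEstimate X t m
      = (t : ℝ)⁻¹ * ∑ s ∈ Finset.range t, if X (s + 1) = m then 1 else 0 := by
    intro t m
    rw [mcEstimate, Finset.sum_bij (fun s _ => s - 1)]
    · intro s hs; simp only [Finset.mem_Icc, Finset.mem_range] at *; omega
    · intro s hs s' hs'; simp only [Finset.mem_Icc] at *; omega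
    · intro s hs; exact ⟨s + 1, by simpa using hs, rfl⟩
    · intro s hs; rw [Nat.sub_add_cancel (Finset.mem_Icc.1 hs).1]
  have hinv : Tendsto (fun t : ℕ => (t : ℝ)⁻¹) atTop (𝓝 0) := tendsto_inv_atTop_nhds_zero_nat
  -- Shifting the time by one changes a frequency by at most `1 / t`.
  have hshift : ∀ m, Tendsto (fun t => mcEstimate X t m - f t m) atTop (𝓝 0) := by
    intro m
    refine squeeze_zero_norm (fun t => ?_) hinv
    rw [hmc, hf, ← mul_sub, ← Finset.sum_sub_distrib,
      Finset.sum_range_sub (fun s => if X s = m then (1 : ℝ) else 0), norm_mul, norm_inv,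
      Real.norm_natCast]
    refine mul_le_of_le_one_right (by positivity) ?_
    split_ifs <;> simp
  have hdefect : ∀ m', Tendsto (fun t => f t m' - ∑ k, f t k * P k m') atTop (𝓝 0) := by
    intro m'
    have h1 := (hX m').sub (hshift m')
    rw [sub_zero] at h1
    refine h1.congr fun t => ?_
    have h2 : ∑ k, f t k * P k m' = (t : ℝ)⁻¹ * ∑ s ∈ Finset.range t, P (X s) m' := by
      simp only [hf]
      simp_rw [mul_assoc, ← Finset.mul_sum, Finset.sum_mul]
      rw [Finset.sum_comm]
      simp
    rw [h2, hmc, Finset.sum_sub_distrib]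
    ring
  have hlim : Tendsto (fun t => c⁻¹ * ∑ m', |f t m' - ∑ k, f t k * P k m'| / ϖ m') atTop
      (𝓝 0) := by
    have h3 : Tendsto (fun t => ∑ m', |f t m' - ∑ k, f t k * P k m'| / ϖ m') atTop
        (𝓝 (∑ m' : M, |(0 : ℝ)| / ϖ m')) :=
      tendsto_finsetSum _ fun m' _ => (hdefect m').abs.div_const _
    simpa using h3.const_mul c⁻¹
  have hfm : Tendsto (fun t => f t m - ϖ m) atTop (𝓝 0) := by
    refine squeeze_zero_norm' ?_ hlim
    filter_upwards [eventually_ge_atTop 1] with t ht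
    refine abs_sub_le_of_reversible hc hP0 hP hPc hϖ hϖ1 hrev ?_ m
    have ht0 : (t : ℝ) ≠ 0 := by exact_mod_cast (by omega : t ≠ 0)
    simp only [hf]
    rw [← Finset.mul_sum, Finset.sum_comm]
    simp [ht0]
  have := ((hshift m).add hfm).add_const (ϖ m)
  simpa using this

/-! ### The law of the inputs -/

section InputLaw

variable {R M W : Type*} [Fintype R] [Fintype M] [MeasurableSpace R] [MeasurableSpace M]
  [MeasurableSpace W]

/-- The law of the drawn kernel and of the proposed model. -/
noncomputable def proposalLaw (Q : ProposalMixture R M) (m : M) : Measure (R × M) :=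
  ∑ r, ∑ m', ENNReal.ofReal (Q.weight r * Q.q r m m') • Measure.dirac (r, m')

/-- The law of the part of the input that does not depend on the current model. -/
noncomputable def noiseLaw (ν : Measure W) [IsProbabilityMeasure ν] (pRand : ℝ) (dim : M → ℕ) :
    Measure ((ℕ → W) × Bool × ((m : M) → Params (dim m)) × ℝ) :=
  (Measure.infinitePi fun _ : ℕ => ν).prod
    ((ENNReal.ofReal pRand • Measure.dirac true
        + ENNReal.ofReal (1 - pRand) • Measure.dirac false).prod
      ((Measure.pi fun m' : M => stdGaussian (Params (dim m'))).prod
        (volume.restrict (Set.Icc (0 : ℝ) 1))))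

lemma inputLaw_eq_prod (Q : ProposalMixture R M) (ν : Measure W) [IsProbabilityMeasure ν]
    (pRand : ℝ) (dim : M → ℕ) (m : M) :
    inputLaw Q ν pRand dim m = (proposalLaw Q m).prod (noiseLaw ν pRand dim) := rfl

instance isProbabilityMeasure_proposalLaw (Q : ProposalMixture R M) (m : M) :
    IsProbabilityMeasure (proposalLaw Q m) := by
  constructor
  have h0 : ∀ r m', 0 ≤ Q.weight r * Q.q r m m' := fun r m' =>
    mul_nonneg (Q.weight_pos r).le (Q.q_nonneg r m m')
  simp only [proposalLaw, Measure.coe_finsetSum, Finset.sum_apply, Measure.smul_apply,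
    measure_univ, smul_eq_mul, mul_one]
  simp_rw [← ENNReal.ofReal_sum_of_nonneg fun m' _ => h0 _ m', ← Finset.mul_sum, Q.q_sum, mul_one]
  rw [← ENNReal.ofReal_sum_of_nonneg fun r _ => (Q.weight_pos r).le, Q.weight_sum,
    ENNReal.ofReal_one]

lemma isProbabilityMeasure_coin {p : ℝ} (hp : p ∈ Set.Icc (0 : ℝ) 1) :
    IsProbabilityMeasure (ENNReal.ofReal p • Measure.dirac true
      + ENNReal.ofReal (1 - p) • Measure.dirac false : Measure Bool) := by
  constructor
  simp only [Measure.add_apply, Measure.smul_apply, measure_univ, smul_eq_mul, mul_one]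
  rw [← ENNReal.ofReal_add hp.1 (sub_nonneg.2 hp.2)]
  simp

lemma isProbabilityMeasure_unitInterval :
    IsProbabilityMeasure (volume.restrict (Set.Icc (0 : ℝ) 1)) :=
  ⟨by simp⟩

variable (ν : Measure W) [IsProbabilityMeasure ν] {pRand : ℝ} (dim : M → ℕ)

lemma isProbabilityMeasure_noiseLaw (hp : pRand ∈ Set.Icc (0 : ℝ) 1) :
    IsProbabilityMeasure (noiseLaw ν pRand dim) := by
  have := isProbabilityMeasure_coin hp
  have := isProbabilityMeasure_unitInterval
  unfold noiseLaw
  infer_instance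

lemma isProbabilityMeasure_inputLaw (Q : ProposalMixture R M) (hp : pRand ∈ Set.Icc (0 : ℝ) 1)
    (m : M) : IsProbabilityMeasure (inputLaw Q ν pRand dim m) := by
  have := isProbabilityMeasure_noiseLaw ν dim hp
  rw [inputLaw_eq_prod]
  infer_instance

lemma noiseLaw_map_seeds (hp : pRand ∈ Set.Icc (0 : ℝ) 1) :
    (noiseLaw ν pRand dim).map Prod.fst = Measure.infinitePi fun _ : ℕ => ν := by
  have := isProbabilityMeasure_coin hp
  have := isProbabilityMeasure_unitInterval
  rw [noiseLaw, Measure.map_fst_prod]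
  simp

lemma noiseLaw_map_gaussian (hp : pRand ∈ Set.Icc (0 : ℝ) 1) :
    (noiseLaw ν pRand dim).map (fun x => x.2.2.1)
      = Measure.pi fun m' : M => stdGaussian (Params (dim m')) := by
  have := isProbabilityMeasure_coin hp
  have := isProbabilityMeasure_unitInterval
  have e : (fun x : (ℕ → W) × Bool × ((m : M) → Params (dim m)) × ℝ => x.2.2.1)
      = Prod.fst ∘ Prod.snd ∘ Prod.snd := rfl
  rw [e, ← Measure.map_map (by fun_prop) (by fun_prop), ← Measure.map_map (by fun_prop)
    (by fun_prop), noiseLaw, Measure.map_snd_prod, measure_univ, one_smul, Measure.map_snd_prod,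
    measure_univ, one_smul, Measure.map_fst_prod, measure_univ, one_smul]

lemma noiseLaw_map_uniform (hp : pRand ∈ Set.Icc (0 : ℝ) 1) :
    (noiseLaw ν pRand dim).map (fun x => x.2.2.2) = volume.restrict (Set.Icc (0 : ℝ) 1) := by
  have := isProbabilityMeasure_coin hp
  have e : (fun x : (ℕ → W) × Bool × ((m : M) → Params (dim m)) × ℝ => x.2.2.2)
      = Prod.snd ∘ Prod.snd ∘ Prod.snd := rfl
  rw [e, ← Measure.map_map (by fun_prop) (by fun_prop), ← Measure.map_map (by fun_prop)
    (by fun_prop), noiseLaw, Measure.map_snd_prod, measure_univ, one_smul, Measure.map_snd_prod,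
    measure_univ, one_smul, Measure.map_snd_prod, measure_univ, one_smul]

end InputLaw

instance isOpenPosMeasure_stdGaussian (E : Type*) [NormedAddCommGroup E] [InnerProductSpace ℝ E]
    [FiniteDimensional ℝ E] [MeasurableSpace E] [BorelSpace E] :
    (stdGaussian E).IsOpenPosMeasure := by
  have := (gaussianReal_absolutelyContinuous' 0 one_ne_zero).isOpenPosMeasure
  rw [stdGaussian]
  refine Continuous.isOpenPosMeasure_map (by fun_prop) fun x => ?_
  exact ⟨fun i => (stdOrthonormalBasis ℝ E).repr x i, (stdOrthonormalBasis ℝ E).sum_repr x⟩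

lemma ProposalMixture.exists_pos_le_proposalLaw {R M : Type*} [Fintype R] [Fintype M]
    [MeasurableSpace R] [MeasurableSpace M] [DiscreteMeasurableSpace M] [DiscreteMeasurableSpace R]
    (Q : ProposalMixture R M) :
    ∃ p₀ : ℝ, 0 < p₀ ∧ ∀ x m, p₀ ≤ (proposalLaw Q x).real {y | y.2 = m} := by
  obtain ⟨r, hr⟩ := Q.exists_pos
  obtain ⟨p₀, hp₀, h⟩ := exists_pos_forall_le (f := fun x : M × M => Q.weight r * Q.q r x.1 x.2)
    fun x => mul_pos (Q.weight_pos r) (hr x.1 x.2)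
  refine ⟨p₀, hp₀, fun x m => (h (x, m)).trans ?_⟩
  rw [Measure.real, ← ENNReal.ofReal_le_iff_le_toReal (measure_ne_top _ _)]
  simp only [proposalLaw, Measure.coe_finsetSum, Finset.sum_apply, Measure.smul_apply, smul_eq_mul]
  refine le_trans ?_ (Finset.single_le_sum (f := fun r => ∑ m', ENNReal.ofReal
    (Q.weight r * Q.q r x m') * Measure.dirac (r, m') {y : R × M | y.2 = m})
    (fun _ _ => zero_le) (Finset.mem_univ r))
  refine le_trans ?_ (Finset.single_le_sum (f := fun m' => ENNReal.ofReal
    (Q.weight r * Q.q r x m') * Measure.dirac (r, m') {y : R × M | y.2 = m})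
    (fun _ _ => zero_le) (Finset.mem_univ m))
  simp
/-! ### The limiting Metropolis–Hastings kernel -/

section LimitKernel

variable {R M W : Type*} [Fintype R] [Fintype M] [MeasurableSpace R] [MeasurableSpace M]
  [DiscreteMeasurableSpace M] [DiscreteMeasurableSpace R] [MeasurableSpace W]
  (𝓜 : ModelFamily M) (Q : ProposalMixture R M) (ν : Measure W) [IsProbabilityMeasure ν]
  {pRand : ℝ}

lemma measurableSet_uniform_mem {dim : M → ℕ} {A : R → M → Set ℝ}
    (hA : ∀ r m, MeasurableSet (A r m)) :
    MeasurableSet {x : Input R W dim | x.2.2.2.2 ∈ A x.1.1 x.1.2} := by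
  have e : {x : Input R W dim | x.2.2.2.2 ∈ A x.1.1 x.1.2}
      = ⋃ y : R × M, {x | x.1 = y} ∩ {x | x.2.2.2.2 ∈ A y.1 y.2} := by
    ext x; simp
  rw [e]
  exact MeasurableSet.iUnion fun y => (measurable_fst (.of_discrete (s := {y}))).inter
    (measurable_snd.snd.snd.snd (hA y.1 y.2))

lemma inputLaw_real_uniform_mem (dim : M → ℕ) (hp : pRand ∈ Set.Icc (0 : ℝ) 1) (m : M)
    {A : R → M → Set ℝ} (hA : ∀ r m, MeasurableSet (A r m)) :
    (inputLaw Q ν pRand dim m).real {x | x.2.2.2.2 ∈ A x.1.1 x.1.2}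
      = ∑ r, ∑ m', Q.weight r * Q.q r m m'
        * (volume.restrict (Set.Icc (0 : ℝ) 1)).real (A r m') := by
  have := isProbabilityMeasure_noiseLaw ν dim hp
  have := isProbabilityMeasure_unitInterval
  have h0 : ∀ r m', 0 ≤ Q.weight r * Q.q r m m' := fun r m' =>
    mul_nonneg (Q.weight_pos r).le (Q.q_nonneg r m m')
  have h1 : ∀ y : R × M, noiseLaw ν pRand dim
      (Prod.mk y ⁻¹' {x : Input R W dim | x.2.2.2.2 ∈ A x.1.1 x.1.2})
        = volume.restrict (Set.Icc (0 : ℝ) 1) (A y.1 y.2) := by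
    intro y
    rw [← noiseLaw_map_uniform ν dim hp, Measure.map_apply (by fun_prop) (hA _ _)]
    rfl
  rw [measureReal_def, inputLaw_eq_prod, Measure.prod_apply (measurableSet_uniform_mem hA)]
  simp_rw [h1]
  rw [proposalLaw, lintegral_finsetSum_measure]
  simp_rw [lintegral_finsetSum_measure, lintegral_smul_measure, lintegral_dirac, smul_eq_mul]
  rw [ENNReal.toReal_sum fun r _ => ENNReal.sum_ne_top.2 fun m' _ =>
    ENNReal.mul_ne_top ENNReal.ofReal_ne_top (measure_ne_top _ _)]
  refine Finset.sum_congr rfl fun r _ => ?_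
  rw [ENNReal.toReal_sum fun m' _ =>
    ENNReal.mul_ne_top ENNReal.ofReal_ne_top (measure_ne_top _ _)]
  refine Finset.sum_congr rfl fun m' _ => ?_
  rw [ENNReal.toReal_mul, ENNReal.toReal_ofReal (h0 r m'), measureReal_def]

/-- The next model, if the acceptance probability is computed with the exact values `p_L`. -/
noncomputable def nextModel {dim : M → ℕ} (m : M) (x : Input R W dim) : M :=
  if x.2.2.2.2 ≤ acceptProb 𝓜 Q 𝓜.targetLik x.1.1 m x.1.2 then x.1.2 else m

/-- The transition matrix of the Metropolis–Hastings chain with the exact values `p_L`. -/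
noncomputable def limitKernel (pRand : ℝ) (m m' : M) : ℝ :=
  (inputLaw Q ν pRand 𝓜.dim m).real {x | nextModel 𝓜 Q m x = m'}

lemma measurableSet_nextModel_eq {dim : M → ℕ} (m m' : M) :
    MeasurableSet {x : Input R W dim | nextModel 𝓜 Q m x = m'} := by
  have hA : ∀ (r : R) (m'' : M), MeasurableSet {u : ℝ |
      (if u ≤ acceptProb 𝓜 Q 𝓜.targetLik r m m'' then m'' else m) = m'} := fun r m'' =>
    (Measurable.ite measurableSet_Iic measurable_const measurable_const) (.of_discrete (s := {m'}))
  exact measurableSet_uniform_mem hA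

lemma uniform_real_Iic {a : ℝ} (h0 : 0 ≤ a) (h1 : a ≤ 1) :
    (volume.restrict (Set.Icc (0 : ℝ) 1)).real (Set.Iic a) = a := by
  have e : Set.Iic a ∩ Set.Icc (0 : ℝ) 1 = Set.Icc 0 a := by
    ext x
    simp only [Set.mem_inter_iff, Set.mem_Iic, Set.mem_Icc]
    exact ⟨fun h => ⟨h.2.1, h.1⟩, fun h => ⟨h.2, h.1, h.2.trans h1⟩⟩
  rw [measureReal_restrict_apply measurableSet_Iic, e]
  simp [h0]

lemma uniform_real_abs_sub_le (a : ℝ) {η : ℝ} (hη : 0 ≤ η) :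
    (volume.restrict (Set.Icc (0 : ℝ) 1)).real {u | |u - a| ≤ η} ≤ 2 * η := by
  have e : {u : ℝ | |u - a| ≤ η} = Set.Icc (a - η) (a + η) := by
    ext u
    rw [Set.mem_ofPred_eq, abs_le, Set.mem_Icc]
    constructor <;> rintro ⟨h1, h2⟩ <;> constructor <;> linarith
  have h2 : (volume.restrict (Set.Icc (0 : ℝ) 1)).real {u | |u - a| ≤ η}
      ≤ volume.real {u : ℝ | |u - a| ≤ η} := by
    rw [e]
    exact ENNReal.toReal_mono (by simp) (Measure.restrict_apply_le _ _)
  refine h2.trans ?_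
  rw [e, Real.volume_real_Icc]
  exact max_le (by linarith) (by linarith)

variable {𝓜}

lemma acceptProb_nonneg {p : M → ℝ} (hp : ∀ m, 0 < p m) (r : R) (m m' : M) :
    0 ≤ acceptProb 𝓜 Q p r m m' := by
  have := Q.q_nonneg r m m'
  have := Q.q_nonneg r m' m
  have := 𝓜.modelPrior_pos m
  have := 𝓜.modelPrior_pos m'
  have := hp m
  have := hp m'
  exact le_min zero_le_one (by positivity)

/-- For `m ≠ m'` a transition needs the proposal of `m'` and its acceptance. -/
lemma limitKernel_of_ne (hp : pRand ∈ Set.Icc (0 : ℝ) 1) (hL : ∀ m, 0 < 𝓜.targetLik m) {m m' : M}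
    (hm : m ≠ m') : limitKernel 𝓜 Q ν pRand m m'
      = ∑ r, Q.weight r * Q.q r m m' * acceptProb 𝓜 Q 𝓜.targetLik r m m' := by
  classical
  set A : R → M → Set ℝ := fun r m'' =>
    if m'' = m' then Set.Iic (acceptProb 𝓜 Q 𝓜.targetLik r m m') else ∅ with hA
  have hAm : ∀ r m'', MeasurableSet (A r m'') := by
    intro r m''
    simp only [hA]
    split_ifs
    · exact measurableSet_Iic
    · exact MeasurableSet.empty
  have e : {x : Input R W 𝓜.dim | nextModel 𝓜 Q m x = m'}
      = {x | x.2.2.2.2 ∈ A x.1.1 x.1.2} := by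
    ext x
    simp only [Set.mem_ofPred_eq, nextModel, hA]
    by_cases hx : x.1.2 = m'
    · rw [hx, if_pos rfl, Set.mem_Iic]
      split_ifs with h1
      · simp [h1]
      · simp [h1, hm]
    · rw [if_neg hx]
      split_ifs <;> simp [hx, hm]
  rw [limitKernel, e, inputLaw_real_uniform_mem Q ν 𝓜.dim hp m hAm]
  refine Finset.sum_congr rfl fun r _ => ?_
  rw [Finset.sum_eq_single m' (fun m'' _ hne => by simp [hA, hne]) (by simp)]
  simp only [hA, if_true]
  rw [uniform_real_Iic (acceptProb_nonneg Q hL r m m') (min_le_left _ _)]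

lemma limitKernel_nonneg (m m' : M) : 0 ≤ limitKernel 𝓜 Q ν pRand m m' := measureReal_nonneg

lemma sum_limitKernel (hp : pRand ∈ Set.Icc (0 : ℝ) 1) (m : M) :
    ∑ m', limitKernel 𝓜 Q ν pRand m m' = 1 := by
  have := isProbabilityMeasure_inputLaw ν 𝓜.dim Q hp m
  have h := measureReal_biUnion_finset (μ := inputLaw Q ν pRand 𝓜.dim m) (s := Finset.univ)
    (f := fun m' => {x | nextModel 𝓜 Q m x = m'})
    (fun a _ b _ hab => Set.disjoint_left.2 fun x hx hx' => hab (hx.symm.trans hx'))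
    fun m' _ => measurableSet_nextModel_eq 𝓜 Q m m'
  simp only [limitKernel]
  rw [← h]
  have e : (⋃ m' ∈ Finset.univ, {x : Input R W 𝓜.dim | nextModel 𝓜 Q m x = m'}) = Set.univ := by
    ext x; simp
  rw [e, probReal_univ]

lemma exists_pos_le_limitKernel (hp : pRand ∈ Set.Icc (0 : ℝ) 1) (hL : ∀ m, 0 < 𝓜.targetLik m) :
    ∃ c, 0 < c ∧ ∀ m m', m ≠ m' → c ≤ limitKernel 𝓜 Q ν pRand m m' := by
  obtain ⟨r, hr⟩ := Q.exists_pos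
  have hacc : ∀ m m', 0 < acceptProb 𝓜 Q 𝓜.targetLik r m m' := by
    intro m m'
    have := hr m m'
    have := hr m' m
    have := 𝓜.modelPrior_pos m
    have := 𝓜.modelPrior_pos m'
    have := hL m
    have := hL m'
    exact lt_min one_pos (by positivity)
  obtain ⟨c, hc, h⟩ := exists_pos_forall_le (f := fun x : M × M =>
      Q.weight r * Q.q r x.1 x.2 * acceptProb 𝓜 Q 𝓜.targetLik r x.1 x.2)
    fun x => mul_pos (mul_pos (Q.weight_pos r) (hr _ _)) (hacc _ _)
  refine ⟨c, hc, fun m m' hm => ?_⟩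
  rw [limitKernel_of_ne Q ν hp hL hm]
  refine (h (m, m')).trans (Finset.single_le_sum (f := fun r => Q.weight r * Q.q r m m'
    * acceptProb 𝓜 Q 𝓜.targetLik r m m') (fun r _ => ?_) (Finset.mem_univ r))
  exact mul_nonneg (mul_nonneg (Q.weight_pos r).le (Q.q_nonneg r m m'))
    (acceptProb_nonneg Q hL r m m')

lemma sum_targetLik_mul_pos [Nonempty M] (hL : ∀ m, 0 < 𝓜.targetLik m) :
    0 < ∑ m, 𝓜.targetLik m * 𝓜.modelPrior m :=
  Finset.sum_pos (fun m _ => mul_pos (hL m) (𝓜.modelPrior_pos m)) Finset.univ_nonempty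

lemma target_pos (hL : ∀ m, 0 < 𝓜.targetLik m) (m : M) : 0 < 𝓜.target m :=
  have : Nonempty M := ⟨m⟩
  div_pos (mul_pos (hL m) (𝓜.modelPrior_pos m)) (sum_targetLik_mul_pos hL)

lemma sum_target (hL : ∀ m, 0 < 𝓜.targetLik m) : ∑ m, 𝓜.target m = 1 := by
  have : Nonempty M := by
    by_contra hM
    have := not_nonempty_iff.1 hM
    simpa using 𝓜.modelPrior_sum
  simp only [ModelFamily.target]
  rw [← Finset.sum_div, div_self (sum_targetLik_mul_pos hL).ne']

/-- Detailed balance: the probability flow from `m` to `m'` with kernel `r` is the minimum of an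
expression in `(m, m')` and the same one in `(m', m)`. If `m'` is never proposed from `m`, the
acceptance probability is a quotient by zero, but it does not matter. -/
lemma target_mul_limitKernel (hp : pRand ∈ Set.Icc (0 : ℝ) 1) (hL : ∀ m, 0 < 𝓜.targetLik m)
    (m m' : M) : 𝓜.target m * limitKernel 𝓜 Q ν pRand m m'
      = 𝓜.target m' * limitKernel 𝓜 Q ν pRand m' m := by
  rcases eq_or_ne m m' with rfl | hm
  · rfl
  have hflow : ∀ r m m', 𝓜.targetLik m * 𝓜.modelPrior m
      * (Q.weight r * Q.q r m m' * acceptProb 𝓜 Q 𝓜.targetLik r m m')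
      = Q.weight r * min (𝓜.targetLik m * 𝓜.modelPrior m * Q.q r m m')
        (𝓜.targetLik m' * 𝓜.modelPrior m' * Q.q r m' m) := by
    intro r m m'
    have hx : 0 < 𝓜.targetLik m * 𝓜.modelPrior m := mul_pos (hL m) (𝓜.modelPrior_pos m)
    have hx' : 0 < 𝓜.targetLik m' * 𝓜.modelPrior m' := mul_pos (hL m') (𝓜.modelPrior_pos m')
    have hq' := mul_nonneg hx'.le (Q.q_nonneg r m' m)
    rcases (Q.q_nonneg r m m').eq_or_lt with hq | hq
    · simp [← hq, hq']
    · have hy := mul_pos hx hq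
      calc _ = Q.weight r * ((𝓜.targetLik m * 𝓜.modelPrior m * Q.q r m m')
            * acceptProb 𝓜 Q 𝓜.targetLik r m m') := by ring
        _ = _ := by
            rw [acceptProb, mul_min_of_nonneg _ _ hy.le, mul_one, mul_div_cancel₀ _ hy.ne']
  rw [limitKernel_of_ne Q ν hp hL hm, limitKernel_of_ne Q ν hp hL hm.symm, ModelFamily.target,
    ModelFamily.target, div_mul_eq_mul_div, div_mul_eq_mul_div, Finset.mul_sum, Finset.mul_sum]
  congr 1
  refine Finset.sum_congr rfl fun r _ => ?_
  rw [hflow, hflow, min_comm]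

lemma tendsto_acceptProb {p : ℕ → M → ℝ} (hL : ∀ m, 0 < 𝓜.targetLik m)
    (h : ∀ m, Tendsto (fun s => p s m) atTop (𝓝 (𝓜.targetLik m))) (r : R) (m m' : M) :
    Tendsto (fun s => acceptProb 𝓜 Q (p s) r m m') atTop
      (𝓝 (acceptProb 𝓜 Q 𝓜.targetLik r m m')) := by
  unfold acceptProb
  by_cases hq : Q.q r m m' = 0
  · simp [hq]
  · refine tendsto_const_nhds.min ((((h m').mul_const _).mul_const _).div
      (((h m).mul_const _).mul_const _) ?_)
    exact mul_ne_zero (mul_pos (hL m) (𝓜.modelPrior_pos m)).ne' hq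

end LimitKernel

/-! ### The gap to the maximum and the estimated marginal likelihoods -/

/-- The gap of the log-likelihood at `θ` to its maximum, as an extended nonnegative real, so that
it can be integrated without integrability conditions. -/
noncomputable def ModelFamily.gap {M : Type*} [Fintype M] (𝓜 : ModelFamily M) (m : M)
    (θ : Params (𝓜.dim m)) : ℝ≥0∞ :=
  ENNReal.ofReal (𝓜.logLik m (𝓜.mle m) - 𝓜.logLik m θ)

lemma ModelFamily.measurable_gap {M : Type*} [Fintype M] (𝓜 : ModelFamily M) {m : M}
    (hℓ : Continuous (𝓜.logLik m)) : Measurable (𝓜.gap m) :=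
  (continuous_const.sub hℓ).measurable.ennreal_ofReal

lemma ModelFamily.evalLik_le_targetLik {M : Type*} [Fintype M] (𝓜 : ModelFamily M) {m : M}
    (hmle : ∀ θ, 𝓜.logLik m θ ≤ 𝓜.logLik m (𝓜.mle m)) (θ : Params (𝓜.dim m)) :
    𝓜.evalLik m θ ≤ 𝓜.targetLik m := by
  unfold ModelFamily.targetLik ModelFamily.evalLik
  split_ifs
  · exact le_rfl
  · exact Real.exp_le_exp.2 (sub_le_sub_right (hmle θ) _)

lemma ModelFamily.targetLik_mul_exp_neg_le_evalLik {M : Type*} [Fintype M] (𝓜 : ModelFamily M)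
    {m : M} (hpos : 0 < 𝓜.targetLik m) {θ : Params (𝓜.dim m)} {δ : ℝ} (hδ : 0 ≤ δ)
    (hθ : 𝓜.logLik m (𝓜.mle m) - δ ≤ 𝓜.logLik m θ) :
    𝓜.targetLik m * Real.exp (-δ) ≤ 𝓜.evalLik m θ := by
  by_cases ha : 𝓜.available m
  · have e : 𝓜.evalLik m θ = 𝓜.targetLik m := by
      simp [ModelFamily.targetLik, ModelFamily.evalLik, ha]
    rw [e]
    exact mul_le_of_le_one_right hpos.le (Real.exp_le_one_iff.2 (by linarith))
  · simp only [ModelFamily.targetLik, ModelFamily.evalLik, ha, if_false, ModelFamily.laplaceAt]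
    rw [← Real.exp_add]
    exact Real.exp_le_exp.2 (by linarith)

/-! ### BSGD within an iteration of the algorithm -/

/-- The BSGD iterate for model `m` after `k` iterations of the optimiser in iteration `s` of the
algorithm, if it is not stopped earlier. -/
noncomputable def bsgdPath {R M W Ω : Type*} {dim : M → ℕ} (α : M → ℕ → ℝ)
    (V : (m : M) → Params (dim m) → W → Params (dim m)) (S : ℕ → Ω → AlgState dim)
    (ξ : ℕ → Ω → Input R W dim) (m : M) (s k : ℕ) (ω : Ω) : Params (dim m) :=
  bsgd (α m) (V m) (ξ s ω).2.1 ((S s ω).theta m) ((S s ω).tau m) k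

/-- The number of BSGD iterations made for model `m` in iteration `s` of the algorithm. -/
def bsgdCount {R M W Ω : Type*} [DecidableEq M] {dim : M → ℕ} (ξ : ℕ → Ω → Input R W dim)
    (K : ℕ → Ω → ℕ) (m : M) (s : ℕ) (ω : Ω) : ℕ :=
  if m = (ξ s ω).1.2 then K s ω else 0

/-- One step of stochastic gradient ascent at a random point with a random step size, on an event
`D`, when all of these are independent of the seed `w` of the oracle. -/

lemma measurable_bsgd {Ω W : Type*} [MeasurableSpace W] {m : MeasurableSpace Ω} {d : ℕ}
    {a : ℕ → ℝ} {V : Params d → W → Params d} (hV : Measurable (Function.uncurry V))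
    {w : Ω → ℕ → W} {θ : Ω → Params d} (hθ : Measurable θ) {τ : Ω → ℕ} (hτ : Measurable τ) {k : ℕ}
    (hw : ∀ j < k, Measurable fun ω => w ω j) :
    Measurable fun ω => bsgd a V (w ω) (θ ω) (τ ω) k := by
  induction k with
  | zero => exact hθ
  | succ k ih =>
    have ih' := ih fun j hj => hw j (hj.trans k.lt_succ_self)
    have h1 : Measurable fun ω => a (τ ω + k + 1) := (measurable_from_top (f := a)).comp
      ((hτ.add_const k).add_const 1)
    exact ih'.add (h1.smul (hV.comp (ih'.prodMk (hw k k.lt_succ_self))))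

section Run

variable {R M W Ω : Type*} [Fintype R] [Fintype M] [DecidableEq M] [MeasurableSpace R]
  [MeasurableSpace M] [MeasurableSpace W] {mΩ : MeasurableSpace Ω}
  {μ : Measure Ω} [IsProbabilityMeasure μ]
  {𝓜 : ModelFamily M} {Q : ProposalMixture R M} {ν : Measure W} [IsProbabilityMeasure ν]
  {V : (m : M) → Params (𝓜.dim m) → W → Params (𝓜.dim m)} {α : M → ℕ → ℝ} {U : ℕ}
  {pRand σRand ε : ℝ} {ℱ : Filtration ℕ mΩ} {S : ℕ → Ω → AlgState 𝓜.dim}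
  {ξ : ℕ → Ω → Input R W 𝓜.dim} {K : ℕ → Ω → ℕ}

namespace IsRun

/-! ### Independence of the inputs from the history -/

lemma measurable_input (h : IsRun μ 𝓜 Q ν V α U pRand σRand ε ℱ S ξ K) (s : ℕ) :
    Measurable (ξ s) := (h.input_measurable s).mono (ℱ.le _) le_rfl

lemma measurable_noise (h : IsRun μ 𝓜 Q ν V α U pRand σRand ε ℱ S ξ K) (s : ℕ) :
    Measurable fun ω => (ξ s ω).2 := (h.measurable_input s).snd

lemma measure_inter_input (h : IsRun μ 𝓜 Q ν V α U pRand σRand ε ℱ S ξ K)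
    (s : ℕ) {A : Set Ω} (hA : MeasurableSet[ℱ s] A) {B : Set (Input R W 𝓜.dim)}
    (hB : MeasurableSet B) :
    μ.real (A ∩ ξ s ⁻¹' B) = ∫ ω in A, (inputLaw Q ν pRand 𝓜.dim (S s ω).model).real B ∂μ := by
  have hBm : MeasurableSet (ξ s ⁻¹' B) := h.measurable_input s hB
  rw [← setIntegral_congr_ae (ℱ.le s A hA) ((h.input_law s B hB).mono fun ω hω _ => hω),
    setIntegral_condExp (ℱ.le s) ((integrable_const _).indicator hBm) hA,
    setIntegral_indicator hBm]
  simp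

/-- The randomness of an iteration other than the proposal is independent of the history and of
the proposal, because its law does not depend on the current model. -/
lemma measure_inter_proposal_noise (h : IsRun μ 𝓜 Q ν V α U pRand σRand ε ℱ S ξ K)
    (hp : pRand ∈ Set.Icc (0 : ℝ) 1) (s : ℕ) {A : Set Ω} (hA : MeasurableSet[ℱ s] A)
    {B : Set (R × M)} (hB : MeasurableSet B)
    {C : Set ((ℕ → W) × Bool × ((m : M) → Params (𝓜.dim m)) × ℝ)} (hC : MeasurableSet C) :
    μ (A ∩ (fun ω => (ξ s ω).1) ⁻¹' B ∩ (fun ω => (ξ s ω).2) ⁻¹' C)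
      = μ (A ∩ (fun ω => (ξ s ω).1) ⁻¹' B) * noiseLaw ν pRand 𝓜.dim C := by
  have := isProbabilityMeasure_noiseLaw ν 𝓜.dim hp
  have e1 : A ∩ (fun ω => (ξ s ω).1) ⁻¹' B ∩ (fun ω => (ξ s ω).2) ⁻¹' C
      = A ∩ ξ s ⁻¹' (B ×ˢ C) := by ext; simp [and_assoc]
  have e2 : A ∩ (fun ω => (ξ s ω).1) ⁻¹' B = A ∩ ξ s ⁻¹' (B ×ˢ Set.univ) := by ext; simp
  rw [← ENNReal.toReal_eq_toReal_iff' (measure_ne_top _ _)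
    (ENNReal.mul_ne_top (measure_ne_top _ _) (measure_ne_top _ _)), ENNReal.toReal_mul]
  change μ.real _ = μ.real _ * (noiseLaw ν pRand 𝓜.dim).real C
  rw [e1, e2, h.measure_inter_input s hA (hB.prod hC),
    h.measure_inter_input s hA (hB.prod MeasurableSet.univ), ← integral_mul_const]
  simp [inputLaw_eq_prod, measureReal_prod_prod]

lemma map_noise (h : IsRun μ 𝓜 Q ν V α U pRand σRand ε ℱ S ξ K)
    (hp : pRand ∈ Set.Icc (0 : ℝ) 1) (s : ℕ) :
    μ.map (fun ω => (ξ s ω).2) = noiseLaw ν pRand 𝓜.dim := by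
  ext C hC
  rw [Measure.map_apply (h.measurable_noise s) hC]
  simpa using h.measure_inter_proposal_noise hp s (A := Set.univ) MeasurableSet.univ
    (B := Set.univ) MeasurableSet.univ hC

lemma indep_noise (h : IsRun μ 𝓜 Q ν V α U pRand σRand ε ℱ S ξ K)
    (hp : pRand ∈ Set.Icc (0 : ℝ) 1) (s : ℕ) :
    Indep (ℱ s ⊔ MeasurableSpace.comap (fun ω => (ξ s ω).1) inferInstance)
      (MeasurableSpace.comap (fun ω => (ξ s ω).2) inferInstance) μ := by
  refine indep_sup_of_measure_inter (ℱ.le s) (h.measurable_input s).fst.comap_le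
    (h.measurable_noise s).comap_le ?_
  rintro A _ _ hA ⟨B, hB, rfl⟩ ⟨C, hC, rfl⟩
  rw [h.measure_inter_proposal_noise hp s hA hB hC, ← h.map_noise hp s,
    Measure.map_apply (h.measurable_noise s) hC]

lemma history_sup_proposal_le (h : IsRun μ 𝓜 Q ν V α U pRand σRand ε ℱ S ξ K) (s : ℕ) :
    ℱ s ⊔ MeasurableSpace.comap (fun ω => (ξ s ω).1) inferInstance ≤ mΩ :=
  sup_le (ℱ.le s) (h.measurable_input s).fst.comap_le

lemma map_seeds (h : IsRun μ 𝓜 Q ν V α U pRand σRand ε ℱ S ξ K)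
    (hp : pRand ∈ Set.Icc (0 : ℝ) 1) (s : ℕ) :
    μ.map (fun ω => (ξ s ω).2.1) = Measure.infinitePi fun _ : ℕ => ν := by
  rw [← noiseLaw_map_seeds ν 𝓜.dim hp, ← h.map_noise hp s,
    Measure.map_map measurable_fst (h.measurable_noise s)]
  rfl

lemma map_seed (h : IsRun μ 𝓜 Q ν V α U pRand σRand ε ℱ S ξ K)
    (hp : pRand ∈ Set.Icc (0 : ℝ) 1) (s k : ℕ) :
    μ.map (fun ω => (ξ s ω).2.1 k) = ν := by
  rw [← Measure.infinitePi_map_eval (fun _ : ℕ => ν) k, ← h.map_seeds hp s,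
    Measure.map_map (measurable_pi_apply k) (h.measurable_noise s).fst]
  rfl

/-- What is known in iteration `s` after `k` calls of the gradient oracle. -/
abbrev innerHistory (ℱ : Filtration ℕ mΩ) (ξ : ℕ → Ω → Input R W 𝓜.dim) (s k : ℕ) :
    MeasurableSpace Ω :=
  ℱ s ⊔ MeasurableSpace.comap (fun ω => (ξ s ω).1) inferInstance
    ⊔ ⨆ j : Fin k, MeasurableSpace.comap (fun ω => (ξ s ω).2.1 j) inferInstance

lemma innerHistory_eq (s k : ℕ) : innerHistory ℱ ξ s k
    = ℱ s ⊔ MeasurableSpace.comap (fun ω => (ξ s ω).1) inferInstance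
      ⊔ MeasurableSpace.comap (fun ω (j : Fin k) => (ξ s ω).2.1 j) inferInstance := by
  rw [innerHistory, MeasurableSpace.pi, MeasurableSpace.comap_iSup]
  simp_rw [MeasurableSpace.comap_comp]
  rfl

lemma innerHistory_mono (s : ℕ) : Monotone (innerHistory ℱ ξ s) := by
  intro j k hjk
  refine sup_le_sup_left (iSup_le fun i => ?_) _
  exact le_iSup (fun i : Fin k => MeasurableSpace.comap (fun ω => (ξ s ω).2.1 i) inferInstance)
    (Fin.castLE hjk i)

lemma innerHistory_le (h : IsRun μ 𝓜 Q ν V α U pRand σRand ε ℱ S ξ K) (s k : ℕ) :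
    innerHistory ℱ ξ s k ≤ mΩ := by
  refine sup_le (h.history_sup_proposal_le s) (iSup_le fun j => Measurable.comap_le ?_)
  exact (measurable_pi_apply _).comp (h.measurable_noise s).fst

lemma le_innerHistory (s k : ℕ) : ℱ s ≤ innerHistory ℱ ξ s k := le_sup_left.trans le_sup_left

lemma indep_seed (h : IsRun μ 𝓜 Q ν V α U pRand σRand ε ℱ S ξ K)
    (hp : pRand ∈ Set.Icc (0 : ℝ) 1) (s k : ℕ) :
    Indep (innerHistory ℱ ξ s k)
      (MeasurableSpace.comap (fun ω => (ξ s ω).2.1 k) inferInstance) μ := by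
  rw [innerHistory_eq]
  refine Indep.sup_comap_of_indepFun_map (h.history_sup_proposal_le s)
    (Y := fun ω => (ξ s ω).2.1) (h.measurable_noise s).fst (f := fun w (j : Fin k) => w j)
    (g := fun w => w k) (by fun_prop) (by fun_prop) ?_ ?_
  · refine indep_of_indep_of_le_right (h.indep_noise hp s) ?_
    rw [show (fun ω => (ξ s ω).2.1) = Prod.fst ∘ fun ω => (ξ s ω).2 from rfl,
      ← MeasurableSpace.comap_comp]
    exact MeasurableSpace.comap_mono measurable_fst.comap_le
  · rw [h.map_seeds hp s]
    have h1 : iIndepFun (fun (i : ℕ) (w : ℕ → W) => w i) (Measure.infinitePi fun _ : ℕ => ν) :=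
      iIndepFun_infinitePi (X := fun _ x => x) fun _ => measurable_id
    have h2 := h1.indepFun_finset (Finset.range k) {k} (by simp) fun i => measurable_pi_apply i
    exact h2.comp (φ := fun (x : Finset.range k → W) (j : Fin k) => x ⟨j, by simp⟩)
      (ψ := fun x : ({k} : Finset ℕ) → W => x ⟨k, by simp⟩)
      (measurable_pi_lambda _ fun j => measurable_pi_apply _) (measurable_pi_apply _)

lemma indep_gaussian (h : IsRun μ 𝓜 Q ν V α U pRand σRand ε ℱ S ξ K)
    (hp : pRand ∈ Set.Icc (0 : ℝ) 1) (s : ℕ) :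
    Indep (ℱ s ⊔ MeasurableSpace.comap (fun ω => (ξ s ω).1) inferInstance
        ⊔ MeasurableSpace.comap (fun ω => (ξ s ω).2.1) inferInstance)
      (MeasurableSpace.comap (fun ω => (ξ s ω).2.2.2.1) inferInstance) μ := by
  have := isProbabilityMeasure_coin hp
  have := isProbabilityMeasure_unitInterval
  refine Indep.sup_comap_of_indepFun_map (h.history_sup_proposal_le s)
    (Y := fun ω => (ξ s ω).2) (h.measurable_noise s) (f := Prod.fst)
    (g := fun x => x.2.2.1) (by fun_prop) (by fun_prop) (h.indep_noise hp s) ?_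
  rw [h.map_noise hp s]
  exact indepFun_prod (X := fun w : ℕ → W => w)
    (Y := fun x : Bool × ((m : M) → Params (𝓜.dim m)) × ℝ => x.2.1) measurable_id (by fun_prop)

lemma map_gaussian (h : IsRun μ 𝓜 Q ν V α U pRand σRand ε ℱ S ξ K)
    (hp : pRand ∈ Set.Icc (0 : ℝ) 1) (s : ℕ) :
    μ.map (fun ω => (ξ s ω).2.2.2.1)
      = Measure.pi fun m' : M => stdGaussian (Params (𝓜.dim m')) := by
  rw [← noiseLaw_map_gaussian ν 𝓜.dim hp, ← h.map_noise hp s,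
    Measure.map_map (by fun_prop) (h.measurable_noise s)]
  rfl

/-! ### Measurability of the states -/

lemma model_succ (h : IsRun μ 𝓜 Q ν V α U pRand σRand ε ℱ S ξ K) (s : ℕ) (ω : Ω) :
    (S (s + 1) ω).model =
      if (ξ s ω).2.2.2.2 ≤ acceptProb 𝓜 Q (S (s + 1) ω).popt (ξ s ω).1.1 (S s ω).model (ξ s ω).1.2
      then (ξ s ω).1.2 else (S s ω).model := by
  rw [h.step]; rfl

lemma theta_succ (h : IsRun μ 𝓜 Q ν V α U pRand σRand ε ℱ S ξ K) (s : ℕ) (ω : Ω) (m : M) :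
    (S (s + 1) ω).theta m =
      if m = (ξ s ω).1.2 then
        bsgd (α m) (V m) (ξ s ω).2.1 ((S s ω).theta m) ((S s ω).tau m) (K s ω)
      else (S s ω).theta m := by
  rw [h.step]; rfl

lemma tau_succ (h : IsRun μ 𝓜 Q ν V α U pRand σRand ε ℱ S ξ K) (s : ℕ) (ω : Ω) (m : M) :
    (S (s + 1) ω).tau m =
      if m = (ξ s ω).1.2 then (S s ω).tau m + K s ω else (S s ω).tau m := by
  rw [h.step]; rfl

lemma popt_succ (h : IsRun μ 𝓜 Q ν V α U pRand σRand ε ℱ S ξ K) (s : ℕ) (ω : Ω) (m : M) :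
    (S (s + 1) ω).popt m =
      if m = (ξ s ω).1.2 then
        max ((S s ω).popt m) (𝓜.evalLik m (if (ξ s ω).2.2.1 then
          (S (s + 1) ω).theta m + σRand • (ξ s ω).2.2.2.1 m else (S (s + 1) ω).theta m))
      else (S s ω).popt m := by
  rw [h.step]
  by_cases hm : m = (ξ s ω).1.2
  · subst hm
    simp [algStep]
  · simp [algStep, hm]

/-- What is known in iteration `s` before the randomisation of the result of BSGD. -/
abbrev bsgdHistory (ℱ : Filtration ℕ mΩ) (ξ : ℕ → Ω → Input R W 𝓜.dim) (s : ℕ) :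
    MeasurableSpace Ω :=
  ℱ s ⊔ MeasurableSpace.comap (fun ω => (ξ s ω).1) inferInstance
    ⊔ MeasurableSpace.comap (fun ω => (ξ s ω).2.1) inferInstance

lemma innerHistory_le_bsgdHistory (s k : ℕ) : innerHistory ℱ ξ s k ≤ bsgdHistory ℱ ξ s := by
  refine sup_le_sup_left (iSup_le fun j => ?_) _
  rw [show (fun ω => (ξ s ω).2.1 j) = (fun w : ℕ → W => w j) ∘ fun ω => (ξ s ω).2.1 from rfl,
    ← MeasurableSpace.comap_comp]
  exact MeasurableSpace.comap_mono (measurable_pi_apply _).comap_le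

lemma bsgdHistory_le (h : IsRun μ 𝓜 Q ν V α U pRand σRand ε ℱ S ξ K) (s : ℕ) :
    bsgdHistory ℱ ξ s ≤ ℱ (s + 1) :=
  sup_le (sup_le (ℱ.mono s.le_succ) (h.input_measurable s).fst.comap_le)
    (h.input_measurable s).snd.fst.comap_le

lemma measurable_proposal_innerHistory (s k : ℕ) :
    Measurable[innerHistory ℱ ξ s k] fun ω => (ξ s ω).1 :=
  measurable_iff_comap_le.2 (le_sup_right.trans le_sup_left)

lemma measurable_seed_innerHistory (s : ℕ) {j k : ℕ} (hjk : j < k) :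
    Measurable[innerHistory ℱ ξ s k] fun ω => (ξ s ω).2.1 j :=
  measurable_iff_comap_le.2 ((le_iSup (fun i : Fin k =>
    MeasurableSpace.comap (fun ω => (ξ s ω).2.1 i) inferInstance) ⟨j, hjk⟩).trans le_sup_right)

lemma measurable_K (h : IsRun μ 𝓜 Q ν V α U pRand σRand ε ℱ S ξ K) (s : ℕ) :
    Measurable[bsgdHistory ℱ ξ s] (K s) := by
  refine @measurable_to_countable' ℕ Ω _ _ (bsgdHistory ℱ ξ s) _ fun k => ?_
  exact innerHistory_le_bsgdHistory s k _ (h.K_stopping s k)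

lemma measurable_theta_succ (h : IsRun μ 𝓜 Q ν V α U pRand σRand ε ℱ S ξ K)
    [DiscreteMeasurableSpace M]
    (hV : ∀ m, Measurable (Function.uncurry (V m))) (s : ℕ) {m : M}
    (hθ : Measurable[ℱ s] fun ω => (S s ω).theta m) (hτ : Measurable[ℱ s] fun ω => (S s ω).tau m) :
    Measurable[bsgdHistory ℱ ξ s] fun ω => (S (s + 1) ω).theta m := by
  have hle : ℱ s ≤ bsgdHistory ℱ ξ s := le_sup_left.trans le_sup_left
  have h1 : Measurable[bsgdHistory ℱ ξ s] fun ω => (ξ s ω).1.2 :=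
    measurable_snd.comp (measurable_iff_comap_le.2 (le_sup_right.trans le_sup_left))
  have h2 : Measurable[bsgdHistory ℱ ξ s] fun ω => (ξ s ω).2.1 :=
    measurable_iff_comap_le.2 le_sup_right
  simp_rw [h.theta_succ]
  refine Measurable.ite (h1 (.of_discrete (s := {m' | m = m'}))) ?_ (hθ.mono hle le_rfl)
  exact (h.measurable_K s).apply_countable (F := fun k ω =>
    bsgd (α m) (V m) (ξ s ω).2.1 ((S s ω).theta m) ((S s ω).tau m) k) fun k =>
    measurable_bsgd (hV m) (hθ.mono hle le_rfl) (hτ.mono hle le_rfl) fun j _ =>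
      (measurable_pi_apply j).comp h2

lemma measurable_evalLik (hℓ : ∀ m, Continuous (𝓜.logLik m)) (m : M) :
    Measurable (𝓜.evalLik m) := by
  unfold ModelFamily.evalLik
  split_ifs
  · exact measurable_const
  · exact (Real.continuous_exp.comp ((hℓ m).sub continuous_const)).measurable

variable [DiscreteMeasurableSpace M] [DiscreteMeasurableSpace R]

lemma measurable_state (h : IsRun μ 𝓜 Q ν V α U pRand σRand ε ℱ S ξ K)
    (hℓ : ∀ m, Continuous (𝓜.logLik m)) (hV : ∀ m, Measurable (Function.uncurry (V m))) (s : ℕ) :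
    (Measurable[ℱ s] fun ω => (S s ω).model) ∧ (∀ m, Measurable[ℱ s] fun ω => (S s ω).theta m) ∧
      (∀ m, Measurable[ℱ s] fun ω => (S s ω).tau m) ∧
      ∀ m, Measurable[ℱ s] fun ω => (S s ω).popt m := by
  induction s with
  | zero =>
    refine ⟨h.init_model, h.init_theta, fun m => ?_, fun m => ?_⟩
    · simp_rw [h.init_tau]; exact measurable_const
    · simp_rw [h.init_popt]; exact measurable_const
  | succ s ih =>
    obtain ⟨ihX, ihθ, ihτ, ihp⟩ := ih
    have hle : ℱ s ≤ ℱ (s + 1) := ℱ.mono s.le_succ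
    have hξ := h.input_measurable s
    have hset : ∀ m, MeasurableSet[ℱ (s + 1)] {ω | m = (ξ s ω).1.2} := fun m =>
      hξ.fst.snd (.of_discrete (s := {m' | m = m'}))
    have hθ : ∀ m, Measurable[ℱ (s + 1)] fun ω => (S (s + 1) ω).theta m := fun m =>
      (h.measurable_theta_succ hV s (ihθ m) (ihτ m)).mono (h.bsgdHistory_le s) le_rfl
    have hp : ∀ m, Measurable[ℱ (s + 1)] fun ω => (S (s + 1) ω).popt m := by
      intro m
      simp_rw [h.popt_succ]
      refine Measurable.ite (hset m) ?_ ((ihp m).mono hle le_rfl)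
      refine ((ihp m).mono hle le_rfl).max ((measurable_evalLik hℓ m).comp ?_)
      exact Measurable.ite (hξ.snd.snd.fst (measurableSet_singleton true))
        ((hθ m).add (((measurable_pi_apply m).comp hξ.snd.snd.snd.fst).const_smul σRand)) (hθ m)
    refine ⟨?_, hθ, fun m => ?_, hp⟩
    · simp_rw [h.model_succ]
      have hX := ihX.mono hle le_rfl
      refine Measurable.ite (measurableSet_le hξ.snd.snd.snd.snd ?_) hξ.fst.snd hX
      refine (hξ.fst.fst.prodMk (hX.prodMk hξ.fst.snd)).apply_countable
        (F := fun x ω => acceptProb 𝓜 Q (S (s + 1) ω).popt x.1 x.2.1 x.2.2) fun x => ?_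
      exact measurable_const.min ((((hp _).mul_const _).mul_const _).div
        (((hp _).mul_const _).mul_const _))
    · simp_rw [h.tau_succ]
      exact Measurable.ite (hset m) (((ihτ m).mono hle le_rfl).add
        ((h.measurable_K s).mono (h.bsgdHistory_le s) le_rfl)) ((ihτ m).mono hle le_rfl)

/-! ### Every model is proposed infinitely often -/

lemma le_measureReal_inter_proposal (h : IsRun μ 𝓜 Q ν V α U pRand σRand ε ℱ S ξ K)
    (hp : pRand ∈ Set.Icc (0 : ℝ) 1) {p₀ : ℝ} {m : M}
    (hp₀ : ∀ x, p₀ ≤ (proposalLaw Q x).real {y | y.2 = m})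
    (s : ℕ) {E : Set Ω} (hE : MeasurableSet[ℱ s] E) :
    p₀ * μ.real E ≤ μ.real (E ∩ {ω | (ξ s ω).1.2 = m}) := by
  have := isProbabilityMeasure_noiseLaw ν 𝓜.dim hp
  have := fun x => isProbabilityMeasure_inputLaw ν 𝓜.dim Q hp x
  set B : Set (Input R W 𝓜.dim) := {y : R × M | y.2 = m} ×ˢ Set.univ
  have hB : MeasurableSet B := (MeasurableSet.of_discrete).prod MeasurableSet.univ
  have e : {ω | (ξ s ω).1.2 = m} = ξ s ⁻¹' B := by ext; simp [B]
  have hl : ∀ x, (inputLaw Q ν pRand 𝓜.dim x).real B = (proposalLaw Q x).real {y | y.2 = m} := by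
    intro x
    rw [inputLaw_eq_prod, measureReal_prod_prod]; simp
  rw [e, h.measure_inter_input s hE hB, mul_comm, ← smul_eq_mul, ← setIntegral_const]
  refine setIntegral_mono_ae (integrable_const _).integrableOn ?_ ?_
  · refine Integrable.integrableOn ?_
    exact (integrable_condExp (m := ℱ s) (μ := μ)
      (f := (ξ s ⁻¹' B).indicator fun _ => (1 : ℝ))).congr (h.input_law s B hB)
  · exact ae_of_all _ fun ω => by simpa only [hl] using hp₀ _

lemma ae_frequently_proposal (h : IsRun μ 𝓜 Q ν V α U pRand σRand ε ℱ S ξ K)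
    (hp : pRand ∈ Set.Icc (0 : ℝ) 1) (m : M) :
    ∀ᵐ ω ∂μ, ∃ᶠ s in atTop, (ξ s ω).1.2 = m := by
  have := isProbabilityMeasure_noiseLaw ν 𝓜.dim hp
  obtain ⟨p₀, hp₀, hle⟩ := Q.exists_pos_le_proposalLaw
  set B : Set (Input R W 𝓜.dim) := {y : R × M | y.2 = m} ×ˢ Set.univ
  have hB : MeasurableSet B := (MeasurableSet.of_discrete).prod MeasurableSet.univ
  have hl : ∀ x, p₀ ≤ (inputLaw Q ν pRand 𝓜.dim x).real B := by
    intro x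
    rw [inputLaw_eq_prod, measureReal_prod_prod]
    simpa using hle x m
  filter_upwards [ae_frequently_mem_iff_tendsto_sum_condExp (μ := μ) (ℱ := ℱ)
    (A := fun s => ξ s ⁻¹' B) fun s => h.input_measurable s hB,
    ae_all_iff.2 fun s => h.input_law s B hB] with ω h1 h2
  have h3 : ∃ᶠ s in atTop, ω ∈ ξ s ⁻¹' B := by
    refine h1.2 (tendsto_atTop_mono (fun n => ?_)
      (tendsto_natCast_atTop_atTop.atTop_mul_const hp₀))
    rw [← nsmul_eq_mul]
    conv_lhs => rw [← Finset.card_range n]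
    exact Finset.card_nsmul_le_sum _ _ _ fun k _ => (hl _).trans (h2 k).ge
  exact h3.mono fun s hs => by simpa [B] using hs

lemma monotone_tau (h : IsRun μ 𝓜 Q ν V α U pRand σRand ε ℱ S ξ K) (ω : Ω) (m : M) :
    Monotone fun s => (S s ω).tau m := by
  refine monotone_nat_of_le_succ fun s => ?_
  rw [h.tau_succ]
  split_ifs <;> omega

lemma tau_le (h : IsRun μ 𝓜 Q ν V α U pRand σRand ε ℱ S ξ K) (s : ℕ) (ω : Ω) (m : M) :
    (S s ω).tau m ≤ U * s := by
  induction s with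
  | zero => simp [h.init_tau]
  | succ s ih =>
    have := h.K_le s ω
    rw [h.tau_succ, mul_add]
    split_ifs <;> omega

lemma tendsto_tau (h : IsRun μ 𝓜 Q ν V α U pRand σRand ε ℱ S ξ K) {ω : Ω} {m : M}
    (hω : ∃ᶠ s in atTop, (ξ s ω).1.2 = m) : Tendsto (fun s => (S s ω).tau m) atTop atTop := by
  refine tendsto_atTop_atTop_of_monotone (h.monotone_tau ω m) fun b => ?_
  induction b with
  | zero => exact ⟨0, Nat.zero_le _⟩
  | succ b ih =>
    obtain ⟨s, hs⟩ := ih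
    obtain ⟨s', hs', hm⟩ := (frequently_atTop.1 hω) s
    refine ⟨s' + 1, ?_⟩
    have h1 := h.monotone_tau ω m hs'
    have h2 := h.K_pos s' ω
    rw [h.tau_succ, if_pos hm.symm]
    simp only at h1
    omega

/-! ### The expected progress of BSGD in one iteration of the algorithm -/

lemma measurable_bsgdPath (h : IsRun μ 𝓜 Q ν V α U pRand σRand ε ℱ S ξ K)
    (hℓ : ∀ m, Continuous (𝓜.logLik m)) (hV : ∀ m, Measurable (Function.uncurry (V m))) (m : M)
    (s k : ℕ) : Measurable[innerHistory ℱ ξ s k] (bsgdPath α V S ξ m s k) := by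
  obtain ⟨-, hθs, hτs, -⟩ := h.measurable_state hℓ hV s
  have hle := le_innerHistory (ξ := ξ) (ℱ := ℱ) s k
  exact measurable_bsgd (hV m) ((hθs m).mono hle le_rfl) ((hτs m).mono hle le_rfl)
    fun j hj => measurable_seed_innerHistory s hj

/-- One BSGD iteration within iteration `s`, on an event that is decided before it: the oracle is
called with a seed that is independent of what is known at that time. -/
lemma setLIntegral_gap_bsgdPath_succ_le (h : IsRun μ 𝓜 Q ν V α U pRand σRand ε ℱ S ξ K)
    (hp : pRand ∈ Set.Icc (0 : ℝ) 1) (hℓ : ∀ m, Continuous (𝓜.logLik m))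
    (hV : ∀ m, Measurable (Function.uncurry (V m))) {m : M} (hα : ∀ τ, 1 ≤ τ → 0 < α m τ) {C : ℝ}
    (hC : ∀ (θ : Params (𝓜.dim m)) (a : ℝ), 0 ≤ a →
      ∫⁻ w, 𝓜.gap m (θ + a • V m θ w) ∂ν + ENNReal.ofReal (a * ‖gradient (𝓜.logLik m) θ‖ ^ 2)
        ≤ 𝓜.gap m θ + ENNReal.ofReal (C * a ^ 2))
    (s k : ℕ) {D : Set Ω} (hD : MeasurableSet[innerHistory ℱ ξ s k] D) :
    ∫⁻ ω in D, 𝓜.gap m (bsgdPath α V S ξ m s (k + 1) ω) ∂μ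
        + ∫⁻ ω in D, ENNReal.ofReal (α m ((S s ω).tau m + k + 1)
            * ‖gradient (𝓜.logLik m) (bsgdPath α V S ξ m s k ω)‖ ^ 2) ∂μ
      ≤ ∫⁻ ω in D, 𝓜.gap m (bsgdPath α V S ξ m s k ω) ∂μ
        + ∫⁻ ω in D, ENNReal.ofReal (C * α m ((S s ω).tau m + k + 1) ^ 2) ∂μ := by
  have ha : Measurable[innerHistory ℱ ξ s k] fun ω => α m ((S s ω).tau m + k + 1) :=
    (measurable_from_top (f := fun n : ℕ => α m (n + k + 1))).comp
      (((h.measurable_state hℓ hV s).2.2.1 m).mono (le_innerHistory s k) le_rfl)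
  exact setLIntegral_oracle_step_le (h.innerHistory_le s k) (𝓜.measurable_gap (hℓ m)) (hV m)
    (h.measurable_bsgdPath hℓ hV m s k) ha (fun ω => (hα _ (by omega)).le)
    ((measurable_pi_apply k).comp (h.measurable_noise s).fst) (h.indep_seed hp s k)
    (h.map_seed hp s k) hC hD

lemma theta_succ_eq_bsgdPath (h : IsRun μ 𝓜 Q ν V α U pRand σRand ε ℱ S ξ K) (s : ℕ) (ω : Ω)
    (m : M) : (S (s + 1) ω).theta m = bsgdPath α V S ξ m s (bsgdCount ξ K m s ω) ω := by
  rw [h.theta_succ, bsgdCount]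
  split_ifs <;> rfl

lemma bsgdCount_le (h : IsRun μ 𝓜 Q ν V α U pRand σRand ε ℱ S ξ K) (m : M) (s : ℕ) (ω : Ω) :
    bsgdCount ξ K m s ω ≤ U := by
  have := h.K_le s ω
  unfold bsgdCount
  split_ifs <;> omega

lemma bsgdCount_pos_iff (h : IsRun μ 𝓜 Q ν V α U pRand σRand ε ℱ S ξ K) (m : M) (s : ℕ) (ω : Ω) :
    0 < bsgdCount ξ K m s ω ↔ (ξ s ω).1.2 = m := by
  have := h.K_pos s ω
  unfold bsgdCount
  split_ifs with hm
  · simp only [hm, iff_true]; omega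
  · simp [eq_comm, hm]

/-- Whether a further BSGD iteration is made is decided by what has been observed. -/
lemma measurableSet_lt_bsgdCount (h : IsRun μ 𝓜 Q ν V α U pRand σRand ε ℱ S ξ K) (m : M)
    (s k : ℕ) : MeasurableSet[innerHistory ℱ ξ s k] {ω | k < bsgdCount ξ K m s ω} := by
  have e : {ω | k < bsgdCount ξ K m s ω}
      = (fun ω => (ξ s ω).1) ⁻¹' {y | y.2 = m}
        ∩ (⋃ j ∈ Finset.range (k + 1), {ω | K s ω = j})ᶜ := by
    ext ω
    by_cases hm : (ξ s ω).1.2 = m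
    · simp only [bsgdCount, hm, if_true, Set.mem_ofPred_eq, Set.preimage_ofPred_eq,
        Set.mem_inter_iff, true_and, Set.mem_compl_iff, Set.mem_iUnion, Finset.mem_range,
        exists_prop, not_exists, not_and]
      exact ⟨fun h1 j hj h2 => by omega, fun h1 => by by_contra h2; exact h1 _ (by omega) rfl⟩
    · simp [bsgdCount, hm, Ne.symm hm]
  rw [e]
  refine (measurable_proposal_innerHistory s k .of_discrete).inter (MeasurableSet.compl ?_)
  refine Finset.measurableSet_biUnion _ fun j hj => innerHistory_mono s ?_ _ (h.K_stopping s j)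
  exact Nat.lt_succ_iff.1 (Finset.mem_range.1 hj)

/-- The expected gap after at most `n` BSGD iterations, with the stopping rule taken into account:
the contribution of iteration `k` only counts where it is made. -/
lemma setLIntegral_gap_bsgdPath_min_le (h : IsRun μ 𝓜 Q ν V α U pRand σRand ε ℱ S ξ K)
    (hp : pRand ∈ Set.Icc (0 : ℝ) 1) (hℓ : ∀ m, Continuous (𝓜.logLik m))
    (hV : ∀ m, Measurable (Function.uncurry (V m))) {m : M} (hα : ∀ τ, 1 ≤ τ → 0 < α m τ) {C : ℝ}
    (hC : ∀ (θ : Params (𝓜.dim m)) (a : ℝ), 0 ≤ a →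
      ∫⁻ w, 𝓜.gap m (θ + a • V m θ w) ∂ν + ENNReal.ofReal (a * ‖gradient (𝓜.logLik m) θ‖ ^ 2)
        ≤ 𝓜.gap m θ + ENNReal.ofReal (C * a ^ 2))
    (s : ℕ) {E : Set Ω} (hE : MeasurableSet[ℱ s] E) (n : ℕ) :
    ∫⁻ ω in E, 𝓜.gap m (bsgdPath α V S ξ m s (min n (bsgdCount ξ K m s ω)) ω) ∂μ
        + ∑ k ∈ Finset.range n, ∫⁻ ω in E ∩ {ω | k < bsgdCount ξ K m s ω},
          ENNReal.ofReal (α m ((S s ω).tau m + k + 1)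
            * ‖gradient (𝓜.logLik m) (bsgdPath α V S ξ m s k ω)‖ ^ 2) ∂μ
      ≤ ∫⁻ ω in E, 𝓜.gap m ((S s ω).theta m) ∂μ
        + ∑ k ∈ Finset.range n, ∫⁻ ω in E ∩ {ω | k < bsgdCount ξ K m s ω},
          ENNReal.ofReal (C * α m ((S s ω).tau m + k + 1) ^ 2) ∂μ := by
  induction n with
  | zero => simp [bsgdPath, bsgd]
  | succ n ih =>
    set D : Set Ω := {ω | n < bsgdCount ξ K m s ω} with hD
    have hDm := h.measurableSet_lt_bsgdCount m s n
    have hDm' : MeasurableSet D := h.innerHistory_le s n _ hDm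
    have hEm : MeasurableSet E := ℱ.le s E hE
    have hED : MeasurableSet[innerHistory ℱ ξ s n] (E ∩ D) :=
      (le_innerHistory s n E hE).inter hDm
    have hstep := h.setLIntegral_gap_bsgdPath_succ_le hp hℓ hV hα hC s n hED
    -- The two sides differ only where the optimiser makes its iteration number `n`.
    have e1 : ∫⁻ ω in E ∩ D, 𝓜.gap m (bsgdPath α V S ξ m s (min (n + 1) (bsgdCount ξ K m s ω)) ω) ∂μ
        = ∫⁻ ω in E ∩ D, 𝓜.gap m (bsgdPath α V S ξ m s (n + 1) ω) ∂μ :=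
      setLIntegral_congr_fun (hEm.inter hDm') fun ω hω => by
        simp only [min_eq_left (Nat.succ_le_of_lt hω.2)]
    have e2 : ∫⁻ ω in E ∩ D, 𝓜.gap m (bsgdPath α V S ξ m s (min n (bsgdCount ξ K m s ω)) ω) ∂μ
        = ∫⁻ ω in E ∩ D, 𝓜.gap m (bsgdPath α V S ξ m s n ω) ∂μ :=
      setLIntegral_congr_fun (hEm.inter hDm') fun ω hω => by
        simp only [min_eq_left (show n ≤ bsgdCount ξ K m s ω from le_of_lt hω.2)]
    have e3 : ∫⁻ ω in E \ D, 𝓜.gap m (bsgdPath α V S ξ m s (min (n + 1) (bsgdCount ξ K m s ω)) ω) ∂μ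
        = ∫⁻ ω in E \ D, 𝓜.gap m (bsgdPath α V S ξ m s (min n (bsgdCount ξ K m s ω)) ω) ∂μ :=
      setLIntegral_congr_fun (hEm.diff hDm') fun ω hω => by
        have h1 : bsgdCount ξ K m s ω ≤ n := not_lt.1 hω.2
        simp only [min_eq_right h1, min_eq_right (h1.trans n.le_succ)]
    rw [Finset.sum_range_succ, Finset.sum_range_succ, ← lintegral_inter_add_sdiff _ E hDm', e1, e3]
    rw [← lintegral_inter_add_sdiff _ E hDm', e2] at ih
    exact ENNReal.add_add_add_le_of_add_le hstep ih

/-- While the gradient is bounded below and the step sizes are small, the expected gap decreases in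
an iteration by a multiple of the step size, if the model is proposed. Only the first BSGD
iteration is used for this, as the number of the others is not under control; the second order
errors of all of them are compensated by it. -/
lemma setLIntegral_gap_theta_succ_le (h : IsRun μ 𝓜 Q ν V α U pRand σRand ε ℱ S ξ K)
    (hp : pRand ∈ Set.Icc (0 : ℝ) 1) (hℓ : ∀ m, Continuous (𝓜.logLik m))
    (hV : ∀ m, Measurable (Function.uncurry (V m))) {m : M} (hα : ∀ τ, 1 ≤ τ → 0 < α m τ) {C : ℝ}
    (hC0 : 0 ≤ C)
    (hC : ∀ (θ : Params (𝓜.dim m)) (a : ℝ), 0 ≤ a →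
      ∫⁻ w, 𝓜.gap m (θ + a • V m θ w) ∂ν + ENNReal.ofReal (a * ‖gradient (𝓜.logLik m) θ‖ ^ 2)
        ≤ 𝓜.gap m θ + ENNReal.ofReal (C * a ^ 2))
    {b : ℝ} (hb : 0 ≤ b) (s : ℕ) {E : Set Ω} (hE : MeasurableSet[ℱ s] E)
    (hgrad : ∀ ω ∈ E, 2 * b ≤ ‖gradient (𝓜.logLik m) ((S s ω).theta m)‖ ^ 2)
    (hsum : ∀ ω ∈ E, ∑ k ∈ Finset.range U, C * α m ((S s ω).tau m + k + 1) ^ 2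
      ≤ b * α m ((S s ω).tau m + 1))
    (hle : ∀ ω ∈ E, α m ((S s ω).tau m + 1) ≤ 1) :
    ∫⁻ ω in E, 𝓜.gap m ((S (s + 1) ω).theta m) ∂μ
        + ∫⁻ ω in E ∩ {ω | (ξ s ω).1.2 = m}, ENNReal.ofReal (b * α m ((S s ω).tau m + 1)) ∂μ
      ≤ ∫⁻ ω in E, 𝓜.gap m ((S s ω).theta m) ∂μ := by
  obtain ⟨ω₀⟩ : Nonempty Ω := μ.nonempty_of_neZero
  have hU : 0 < U := (h.K_pos 0 ω₀).trans (h.K_le 0 ω₀)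
  have hmin := h.setLIntegral_gap_bsgdPath_min_le hp hℓ hV hα hC s hE U
  set D : Set Ω := E ∩ {ω | (ξ s ω).1.2 = m} with hD
  have hD0 : E ∩ {ω | 0 < bsgdCount ξ K m s ω} = D := by
    ext ω; simp [hD, h.bsgdCount_pos_iff]
  have hDm : MeasurableSet D :=
    (ℱ.le s E hE).inter ((h.measurable_input s).fst.snd (.of_discrete (s := {m})))
  have hτ : Measurable fun ω => (S s ω).tau m :=
    ((h.measurable_state hℓ hV s).2.2.1 m).mono (ℱ.le s) le_rfl
  have hαm : ∀ f : ℕ → ℝ, Measurable fun ω => ENNReal.ofReal (f ((S s ω).tau m)) := fun f =>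
    ((measurable_from_top (f := f)).comp hτ).ennreal_ofReal
  have hα0 : ∀ ω, 0 ≤ α m ((S s ω).tau m + 1) := fun ω => (hα _ (by omega)).le
  have e1 : ∫⁻ ω in E, 𝓜.gap m (bsgdPath α V S ξ m s (min U (bsgdCount ξ K m s ω)) ω) ∂μ
      = ∫⁻ ω in E, 𝓜.gap m ((S (s + 1) ω).theta m) ∂μ := by
    simp_rw [min_eq_right (h.bsgdCount_le m s _), ← h.theta_succ_eq_bsgdPath]
  have e2 : ∫⁻ ω in D, ENNReal.ofReal (b * α m ((S s ω).tau m + 1)) ∂μ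
        + ∫⁻ ω in D, ENNReal.ofReal (b * α m ((S s ω).tau m + 1)) ∂μ
      ≤ ∑ k ∈ Finset.range U, ∫⁻ ω in E ∩ {ω | k < bsgdCount ξ K m s ω},
          ENNReal.ofReal (α m ((S s ω).tau m + k + 1)
            * ‖gradient (𝓜.logLik m) (bsgdPath α V S ξ m s k ω)‖ ^ 2) ∂μ := by
    refine le_trans ?_ (Finset.single_le_sum (fun _ _ => zero_le) (Finset.mem_range.2 hU))
    rw [hD0, ← lintegral_add_left (hαm fun n => b * α m (n + 1))]
    refine setLIntegral_mono' hDm fun ω hω => ?_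
    have h0 := hα0 ω
    rw [← ENNReal.ofReal_add (by positivity) (by positivity)]
    refine ENNReal.ofReal_le_ofReal ?_
    have h1 := mul_le_mul_of_nonneg_left (hgrad ω hω.1) h0
    calc _ = α m ((S s ω).tau m + 1) * (2 * b) := by ring
      _ ≤ _ := h1
  have e3 : ∑ k ∈ Finset.range U, ∫⁻ ω in E ∩ {ω | k < bsgdCount ξ K m s ω},
          ENNReal.ofReal (C * α m ((S s ω).tau m + k + 1) ^ 2) ∂μ
      ≤ ∫⁻ ω in D, ENNReal.ofReal (b * α m ((S s ω).tau m + 1)) ∂μ := by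
    calc _ ≤ ∑ k ∈ Finset.range U, ∫⁻ ω in D,
          ENNReal.ofReal (C * α m ((S s ω).tau m + k + 1) ^ 2) ∂μ := by
          gcongr with k _
          rw [← hD0]
          exact Set.inter_subset_inter_right _ fun ω hω => (Nat.zero_le k).trans_lt hω
      _ = ∫⁻ ω in D, ∑ k ∈ Finset.range U,
          ENNReal.ofReal (C * α m ((S s ω).tau m + k + 1) ^ 2) ∂μ :=
          (lintegral_finsetSum _ fun k _ => hαm fun n => C * α m (n + k + 1) ^ 2).symm
      _ ≤ _ := by
          refine setLIntegral_mono' hDm fun ω hω => ?_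
          rw [← ENNReal.ofReal_sum_of_nonneg fun k _ => by positivity]
          exact ENNReal.ofReal_le_ofReal (hsum ω hω.1)
  have hfin : ∫⁻ ω in D, ENNReal.ofReal (b * α m ((S s ω).tau m + 1)) ∂μ ≠ ∞ := by
    refine ne_top_of_le_ne_top (b := ∫⁻ ω in D, ENNReal.ofReal b ∂μ) ?_ ?_
    · rw [setLIntegral_const]
      exact ENNReal.mul_ne_top ENNReal.ofReal_ne_top (measure_ne_top _ _)
    · exact setLIntegral_mono' hDm fun ω hω =>
        ENNReal.ofReal_le_ofReal (mul_le_of_le_one_right hb (hle ω hω.1))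
  rw [e1] at hmin
  refine (ENNReal.add_le_add_iff_right hfin).1 ?_
  calc _ = ∫⁻ ω in E, 𝓜.gap m ((S (s + 1) ω).theta m) ∂μ + (_ + _) := add_assoc _ _ _
    _ ≤ _ := add_le_add_right e2 _
    _ ≤ _ := hmin
    _ ≤ _ := add_le_add_right e3 _

/-! ### Recurrence of BSGD to the maximum -/

/-- A supermartingale argument: as long as the gap is not below `δ`, its expectation decreases in
iteration `s` by at least a multiple of `1 / s`, which cannot go on forever. -/
lemma measure_forall_le_gap_eq_zero (h : IsRun μ 𝓜 Q ν V α U pRand σRand ε ℱ S ξ K)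
    (hp : pRand ∈ Set.Icc (0 : ℝ) 1) (hℓ : ∀ m, Continuous (𝓜.logLik m))
    (hV : ∀ m, Measurable (Function.uncurry (V m))) {m : M} (hα : ∀ τ, 1 ≤ τ → 0 < α m τ) {C : ℝ}
    (hC0 : 0 ≤ C)
    (hC : ∀ (θ : Params (𝓜.dim m)) (a : ℝ), 0 ≤ a →
      ∫⁻ w, 𝓜.gap m (θ + a • V m θ w) ∂ν + ENNReal.ofReal (a * ‖gradient (𝓜.logLik m) θ‖ ^ 2)
        ≤ 𝓜.gap m θ + ENNReal.ofReal (C * a ^ 2))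
    {b : ℝ} (hb : 0 < b) {δ : ℝ≥0∞}
    (hgrad : ∀ θ, δ ≤ 𝓜.gap m θ → 2 * b ≤ ‖gradient (𝓜.logLik m) θ‖ ^ 2) {T : ℕ} {κ : ℝ}
    (hκ : 0 < κ) (hT : ∀ τ, T ≤ τ →
      ∑ k ∈ Finset.range U, C * α m (τ + k + 1) ^ 2 ≤ b * α m (τ + 1) ∧
        κ / (τ + 1) ≤ α m (τ + 1) ∧ α m (τ + 1) ≤ 1) (N B : ℕ) :
    μ {ω | T ≤ (S N ω).tau m ∧ 𝓜.gap m ((S N ω).theta m) ≤ B ∧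
      ∀ s, N ≤ s → δ ≤ 𝓜.gap m ((S s ω).theta m)} = 0 := by
  obtain ⟨p₀, hp₀, hprop⟩ := Q.exists_pos_le_proposalLaw
  set E : ℕ → Set Ω := fun n => {ω | T ≤ (S N ω).tau m ∧ 𝓜.gap m ((S N ω).theta m) ≤ B ∧
      ∀ i ∈ Finset.range (n + 1), δ ≤ 𝓜.gap m ((S (N + i) ω).theta m)} with hEdef
  set E' : Set Ω := {ω | T ≤ (S N ω).tau m ∧ 𝓜.gap m ((S N ω).theta m) ≤ B ∧
      ∀ s, N ≤ s → δ ≤ 𝓜.gap m ((S s ω).theta m)} with hE'def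
  have hgm : ∀ s, Measurable[ℱ s] fun ω => 𝓜.gap m ((S s ω).theta m) := fun s =>
    (𝓜.measurable_gap (hℓ m)).comp ((h.measurable_state hℓ hV s).2.1 m)
  have hEm : ∀ n, MeasurableSet[ℱ (N + n)] (E n) := by
    intro n
    have hN := ℱ.mono (Nat.le_add_right N n)
    refine (((h.measurable_state hℓ hV N).2.2.1 m).mono hN le_rfl (.of_discrete
      (s := Set.Ici T))).inter (((hgm N).mono hN le_rfl measurableSet_Iic).inter ?_)
    have e : {ω | ∀ i ∈ Finset.range (n + 1), δ ≤ 𝓜.gap m ((S (N + i) ω).theta m)}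
        = ⋂ i ∈ Finset.range (n + 1), {ω | δ ≤ 𝓜.gap m ((S (N + i) ω).theta m)} := by
      ext; simp
    change MeasurableSet[ℱ (N + n)]
      {ω | ∀ i ∈ Finset.range (n + 1), δ ≤ 𝓜.gap m ((S (N + i) ω).theta m)}
    rw [e]
    refine Finset.measurableSet_biInter _ fun i hi => ?_
    exact (hgm (N + i)).mono (ℱ.mono (by simpa [Nat.lt_succ_iff] using hi)) le_rfl
      measurableSet_Ici
  have hsub : ∀ n, E' ⊆ E n := fun n ω hω =>
    ⟨hω.1, hω.2.1, fun i _ => hω.2.2 _ (Nat.le_add_right _ _)⟩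
  have hanti : ∀ n, E (n + 1) ⊆ E n := fun n ω hω =>
    ⟨hω.1, hω.2.1, fun i hi => hω.2.2 i (Finset.mem_range.2
      ((Finset.mem_range.1 hi).trans (Nat.lt_succ_self _)))⟩
  have hstep : ∀ n, ∫⁻ ω in E (n + 1), 𝓜.gap m ((S (N + (n + 1)) ω).theta m) ∂μ
      + ENNReal.ofReal (b * (κ / (U * (N + n) + 1)) * p₀) * μ E'
      ≤ ∫⁻ ω in E n, 𝓜.gap m ((S (N + n) ω).theta m) ∂μ := by
    intro n
    have hτ : ∀ ω ∈ E n, T ≤ (S (N + n) ω).tau m := fun ω hω =>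
      hω.1.trans (h.monotone_tau ω m (Nat.le_add_right N n))
    have hmain := h.setLIntegral_gap_theta_succ_le hp hℓ hV hα hC0 hC hb.le (N + n) (hEm n)
      (fun ω hω => hgrad _ (hω.2.2 n (by simp))) (fun ω hω => (hT _ (hτ ω hω)).1)
      (fun ω hω => (hT _ (hτ ω hω)).2.2)
    refine le_trans (add_le_add (lintegral_mono_set (hanti n)) ?_) hmain
    have hDm : MeasurableSet (E n ∩ {ω | (ξ (N + n) ω).1.2 = m}) :=
      (ℱ.le _ _ (hEm n)).inter ((h.measurable_input _).fst.snd (.of_discrete (s := {m})))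
    calc ENNReal.ofReal (b * (κ / (U * (N + n) + 1)) * p₀) * μ E'
        ≤ ENNReal.ofReal (b * (κ / (U * (N + n) + 1)) * p₀) * μ (E n) := by gcongr; exact hsub n
      _ = ENNReal.ofReal (b * (κ / (U * (N + n) + 1))) * ENNReal.ofReal (p₀ * μ.real (E n)) := by
        rw [ENNReal.ofReal_mul (by positivity), ENNReal.ofReal_mul hp₀.le, mul_assoc,
          Measure.real, ENNReal.ofReal_toReal (measure_ne_top _ _)]
      _ ≤ ENNReal.ofReal (b * (κ / (U * (N + n) + 1)))
          * μ (E n ∩ {ω | (ξ (N + n) ω).1.2 = m}) := by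
        gcongr
        refine (ENNReal.ofReal_le_ofReal (h.le_measureReal_inter_proposal hp
          (fun x => hprop x m) (N + n) (hEm n))).trans ?_
        rw [Measure.real, ENNReal.ofReal_toReal (measure_ne_top _ _)]
      _ = ∫⁻ ω in E n ∩ {ω | (ξ (N + n) ω).1.2 = m},
          ENNReal.ofReal (b * (κ / (U * (N + n) + 1))) ∂μ := (setLIntegral_const _ _).symm
      _ ≤ _ := by
        refine setLIntegral_mono' hDm fun ω hω => ENNReal.ofReal_le_ofReal ?_
        gcongr
        refine le_trans ?_ (hT _ (hτ ω hω.1)).2.1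
        gcongr
        exact_mod_cast h.tau_le (N + n) ω m
  have hsum : ∀ n, ∫⁻ ω in E n, 𝓜.gap m ((S (N + n) ω).theta m) ∂μ
      + ∑ i ∈ Finset.range n, ENNReal.ofReal (b * (κ / (U * (N + i) + 1)) * p₀) * μ E' ≤ B := by
    intro n
    induction n with
    | zero =>
      simp only [Finset.range_zero, Finset.sum_empty, add_zero]
      calc ∫⁻ ω in E 0, 𝓜.gap m ((S N ω).theta m) ∂μ ≤ ∫⁻ ω in E 0, (B : ℝ≥0∞) ∂μ :=
            setLIntegral_mono' (ℱ.le _ _ (hEm 0)) fun ω hω => hω.2.1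
        _ ≤ B := by
            rw [setLIntegral_const]
            exact mul_le_of_le_one_right zero_le prob_le_one
    | succ n ih =>
      rw [Finset.sum_range_succ, add_comm (Finset.sum _ _), ← add_assoc]
      exact (add_le_add_left (hstep n) _).trans ih
  by_contra hne
  have hx : 0 < μ.real E' := ENNReal.toReal_pos hne (measure_ne_top _ _)
  set x := μ.real E'
  -- The partial sums are bounded below by those of a multiple of the harmonic series.
  set c := b * (κ / (U * N + U + 1)) * p₀ * x with hc
  have hcpos : 0 < c := by positivity
  have hbound : ∀ n, c * ∑ i ∈ Finset.range n, 1 / ((i : ℝ) + 1) ≤ B := by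
    intro n
    have h1 := le_add_self.trans (hsum n)
    have h2 : ∑ i ∈ Finset.range n, ENNReal.ofReal (b * (κ / (U * (N + i) + 1)) * p₀) * μ E'
        = ENNReal.ofReal (∑ i ∈ Finset.range n, b * (κ / (U * (N + i) + 1)) * p₀ * x) := by
      rw [ENNReal.ofReal_sum_of_nonneg fun i _ => by positivity]
      refine Finset.sum_congr rfl fun i _ => ?_
      rw [ENNReal.ofReal_mul (q := x) (by positivity),
        show ENNReal.ofReal x = μ E' from ENNReal.ofReal_toReal (measure_ne_top _ _)]
    rw [h2] at h1
    have h3 : ∑ i ∈ Finset.range n, b * (κ / (U * (N + i) + 1)) * p₀ * x ≤ B := by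
      have := ENNReal.toReal_mono (ENNReal.natCast_ne_top B) h1
      rwa [ENNReal.toReal_ofReal (Finset.sum_nonneg fun i _ => by positivity),
        ENNReal.toReal_natCast] at this
    refine le_trans ?_ h3
    rw [Finset.mul_sum]
    refine Finset.sum_le_sum fun i _ => ?_
    have h4 : κ / (U * N + U + 1) * (1 / ((i : ℝ) + 1)) ≤ κ / (U * (N + i) + 1) := by
      rw [div_mul_div_comm, mul_one]
      gcongr
      have : (0 : ℝ) ≤ U * N * i := by positivity
      have hi : (0 : ℝ) ≤ i := by positivity
      have hU : (0 : ℝ) ≤ U := by positivity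
      nlinarith
    calc c * (1 / ((i : ℝ) + 1)) = b * (κ / (U * N + U + 1) * (1 / ((i : ℝ) + 1))) * p₀ * x := by
          rw [hc]; ring
      _ ≤ _ := by gcongr
  obtain ⟨n, hn⟩ := ((Real.tendsto_sum_range_one_div_nat_succ_atTop.const_mul_atTop
    hcpos).eventually_gt_atTop (B : ℝ)).exists
  exact absurd (hbound n) (not_le.2 hn)

lemma ae_frequently_gap_lt (h : IsRun μ 𝓜 Q ν V α U pRand σRand ε ℱ S ξ K)
    (hp : pRand ∈ Set.Icc (0 : ℝ) 1) (hLip : ∀ m, LipschitzLogLik (𝓜.logLik m))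
    (hV : ∀ m, Measurable (Function.uncurry (V m))) {m : M} {q σ l : ℝ}
    (hConc : ConcaveOn ℝ Set.univ (𝓜.logLik m)) (hCoer : CoerciveLogLik (𝓜.logLik m))
    (hFlat : AsymptoticallyFlatCond (𝓜.logLik m))
    (hOracle : IsFirstOrderOracle ν (𝓜.logLik m) (V m) q σ) (hl0 : 0 < l) (hl1 : l ≤ 1)
    (hα : IsStepSize (α m) l) {δ : ℝ} (hδ : 0 < δ) :
    ∀ᵐ ω ∂μ, ∃ᶠ s in atTop, 𝓜.gap m ((S s ω).theta m) < ENNReal.ofReal δ := by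
  have hℓ : ∀ m, Continuous (𝓜.logLik m) := fun m => (hLip m).1.continuous
  have hmle := 𝓜.logLik_le_mle (hℓ m) hCoer
  obtain ⟨C, hC0, hC⟩ := hOracle.lintegral_gap_step_le hConc (hLip m) hmle
  obtain ⟨c, hc, hgrad⟩ := exists_le_norm_gradient hConc (hLip m).1 hFlat (𝓜.mle m) hδ
  have hb : 0 < c ^ 2 / 2 := by positivity
  obtain ⟨T, κ, hκ, hT⟩ := hα.exists_forall_ge hl0 hl1 U hb hC0
  have hgrad' : ∀ θ, ENNReal.ofReal δ ≤ 𝓜.gap m θ →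
      2 * (c ^ 2 / 2) ≤ ‖gradient (𝓜.logLik m) θ‖ ^ 2 := by
    intro θ hθ
    have h1 := hgrad θ ((ENNReal.ofReal_le_ofReal_iff (sub_nonneg.2 (hmle θ))).1 hθ)
    rw [mul_div_cancel₀ _ (two_ne_zero)]
    gcongr
  have hnull : ∀ᵐ ω ∂μ, ∀ N B : ℕ, ¬ (T ≤ (S N ω).tau m ∧ 𝓜.gap m ((S N ω).theta m) ≤ B ∧
      ∀ s, N ≤ s → ENNReal.ofReal δ ≤ 𝓜.gap m ((S s ω).theta m)) := by
    rw [ae_all_iff]; intro N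
    rw [ae_all_iff]; intro B
    rw [ae_iff]
    simp only [not_not]
    exact h.measure_forall_le_gap_eq_zero hp hℓ hV hα.1 hC0 hC hb hgrad' hκ hT N B
  -- If the gap is eventually at least `δ`, then a starting time `N` with `T ≤ τ` and a bound `B` of
  -- the gap at that time put `ω` into one of countably many null sets.
  filter_upwards [hnull, h.ae_frequently_proposal hp m] with ω h1 h2
  by_contra h3
  simp only [not_frequently, not_lt] at h3
  obtain ⟨N, hN⟩ := eventually_atTop.1
    (h3.and ((h.tendsto_tau h2).eventually_ge_atTop T))
  obtain ⟨B, hB⟩ := exists_nat_ge (𝓜.logLik m (𝓜.mle m) - 𝓜.logLik m ((S N ω).theta m))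
  refine h1 N B ⟨(hN N le_rfl).2, ?_, fun s hs => (hN s hs).1⟩
  rw [← ENNReal.ofReal_natCast]
  exact ENNReal.ofReal_le_ofReal hB

/-- The parameter value only changes when the model is proposed. -/
lemma frequently_proposal_and_gap_lt (h : IsRun μ 𝓜 Q ν V α U pRand σRand ε ℱ S ξ K) {m : M}
    {ω : Ω} {δ : ℝ≥0∞} (h₁ : ∃ᶠ s in atTop, (ξ s ω).1.2 = m)
    (h₂ : ∃ᶠ s in atTop, 𝓜.gap m ((S s ω).theta m) < δ) :
    ∃ᶠ s in atTop, (ξ s ω).1.2 = m ∧ 𝓜.gap m ((S (s + 1) ω).theta m) < δ := by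
  by_contra h3
  obtain ⟨N, hN⟩ := eventually_atTop.1 (not_frequently.1 h3)
  obtain ⟨s₀, hs₀, hm⟩ := frequently_atTop.1 h₁ N
  have h4 : ∀ s, s₀ + 1 ≤ s → ¬ 𝓜.gap m ((S s ω).theta m) < δ := by
    intro s hs
    induction s, hs using Nat.le_induction with
    | base => exact fun h5 => hN s₀ hs₀ ⟨hm, h5⟩
    | succ s hs ih =>
      by_cases hms : (ξ s ω).1.2 = m
      · exact fun h5 => hN s (by omega) ⟨hms, h5⟩
      · rwa [h.theta_succ, if_neg (Ne.symm hms)]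
  obtain ⟨s, hs, h6⟩ := frequently_atTop.1 h₂ (s₀ + 1)
  exact h4 s hs h6

/-! ### The effect of the randomisation -/

/-- Events `B s` that are decided before the randomisation and occur infinitely often do so
together with a small randomising vector. -/
lemma ae_frequently_and_noise_small (h : IsRun μ 𝓜 Q ν V α U pRand σRand ε ℱ S ξ K)
    (hp : pRand ∈ Set.Icc (0 : ℝ) 1) (m : M) {η : ℝ} (hη : 0 < η) {B : ℕ → Set Ω}
    (hB : ∀ s, MeasurableSet[bsgdHistory ℱ ξ s] (B s)) :
    ∀ᵐ ω ∂μ, (∃ᶠ s in atTop, ω ∈ B s) →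
      ∃ᶠ s in atTop, ω ∈ B s ∧ ‖σRand • (ξ s ω).2.2.2.1 m‖ < η := by
  set G : Set ((m : M) → Params (𝓜.dim m)) := {z | ‖σRand • z m‖ < η} with hG
  have hGo : IsOpen G := isOpen_lt (by fun_prop) continuous_const
  have hGm : MeasurableSet G := hGo.measurableSet
  set γ := Measure.pi fun m' : M => stdGaussian (Params (𝓜.dim m'))
  have hc : 0 < γ.real G := ENNReal.toReal_pos
    (hGo.measure_pos γ ⟨0, by simpa [hG] using hη⟩).ne' (measure_ne_top _ _)
  set Z : ℕ → Set Ω := fun s => (fun ω => (ξ s ω).2.2.2.1) ⁻¹' G with hZ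
  have hzm : ∀ s, Measurable[ℱ (s + 1)] fun ω => (ξ s ω).2.2.2.1 := fun s =>
    (h.input_measurable s).snd.snd.snd.fst
  have hBm : ∀ s, MeasurableSet[ℱ (s + 1)] (B s) := fun s => h.bsgdHistory_le s _ (hB s)
  have hcond : ∀ s, μ[(B s ∩ Z s).indicator (1 : Ω → ℝ) | ℱ s]
      =ᵐ[μ] fun ω => γ.real G * (μ[(B s).indicator (1 : Ω → ℝ) | ℱ s]) ω := by
    intro s
    have hle1 : ℱ s ≤ bsgdHistory ℱ ξ s := le_sup_left.trans le_sup_left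
    have hle2 : bsgdHistory ℱ ξ s ≤ mΩ := (h.bsgdHistory_le s).trans (ℱ.le _)
    have hzm' : Measurable fun ω => (ξ s ω).2.2.2.1 := (hzm s).mono (ℱ.le _) le_rfl
    have hZm : MeasurableSet (Z s) := hzm' hGm
    have e1 : μ[(Z s).indicator (1 : Ω → ℝ) | bsgdHistory ℱ ξ s] =ᵐ[μ] fun _ => γ.real G := by
      have h1 := condExp_indep_eq (μ := μ) (f := (Z s).indicator (1 : Ω → ℝ)) hzm'.comap_le hle2
        (Measurable.stronglyMeasurable (Measurable.indicator
          (@measurable_const _ _ _ _ (1 : ℝ)) ⟨G, hGm, rfl⟩)) (h.indep_gaussian hp s).symm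
      refine h1.trans (ae_of_all _ fun _ => ?_)
      have hγ : μ.map (fun ω => (ξ s ω).2.2.2.1) = γ := h.map_gaussian hp s
      simp only
      rw [integral_indicator_one hZm, ← hγ, measureReal_def, measureReal_def,
        Measure.map_apply hzm' hGm]
    have e2 : μ[(B s ∩ Z s).indicator (1 : Ω → ℝ) | bsgdHistory ℱ ξ s]
        =ᵐ[μ] fun ω => γ.real G * (B s).indicator (1 : Ω → ℝ) ω := by
      rw [← Set.indicator_indicator]
      have hint : Integrable ((Z s).indicator (1 : Ω → ℝ)) μ :=
        (integrable_const (1 : ℝ)).indicator hZm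
      refine (condExp_indicator hint (hB s)).trans ?_
      filter_upwards [e1] with ω hω
      by_cases hωB : ω ∈ B s <;> simp [hωB, hω]
    calc μ[(B s ∩ Z s).indicator (1 : Ω → ℝ) | ℱ s]
        =ᵐ[μ] μ[μ[(B s ∩ Z s).indicator (1 : Ω → ℝ) | bsgdHistory ℱ ξ s] | ℱ s] :=
          (condExp_condExp_of_le hle1 hle2).symm
      _ =ᵐ[μ] μ[fun ω => γ.real G * (B s).indicator (1 : Ω → ℝ) ω | ℱ s] := condExp_congr_ae e2
      _ =ᵐ[μ] _ := condExp_smul (γ.real G) ((B s).indicator (1 : Ω → ℝ)) (ℱ s)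
  filter_upwards [ae_frequently_mem_iff_tendsto_sum_condExp (μ := μ) (ℱ := ℱ) hBm,
    ae_frequently_mem_iff_tendsto_sum_condExp (μ := μ) (ℱ := ℱ) (A := fun s => B s ∩ Z s)
      fun s => (hBm s).inter (hzm s hGm), ae_all_iff.2 hcond] with ω h1 h2 h3 h4
  refine h2.2 ?_
  simp_rw [h3, ← Finset.mul_sum]
  exact (h1.1 h4).const_mul_atTop hc

/-! ### Convergence of the estimated marginal likelihoods -/

lemma monotone_popt (h : IsRun μ 𝓜 Q ν V α U pRand σRand ε ℱ S ξ K) (ω : Ω) (m : M) :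
    Monotone fun s => (S s ω).popt m := by
  refine monotone_nat_of_le_succ fun s => ?_
  rw [h.popt_succ]
  split_ifs
  · exact le_max_left _ _
  · exact le_max_left _ _
  · exact le_rfl

lemma popt_le_targetLik (h : IsRun μ 𝓜 Q ν V α U pRand σRand ε ℱ S ξ K) {m : M}
    (hmle : ∀ θ, 𝓜.logLik m θ ≤ 𝓜.logLik m (𝓜.mle m)) (hε : ε ≤ 𝓜.targetLik m) (s : ℕ) (ω : Ω) :
    (S s ω).popt m ≤ 𝓜.targetLik m := by
  induction s with
  | zero => rwa [h.init_popt]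
  | succ s ih =>
    rw [h.popt_succ]
    split_ifs
    · exact max_le ih (𝓜.evalLik_le_targetLik hmle _)
    · exact max_le ih (𝓜.evalLik_le_targetLik hmle _)
    · exact ih

lemma ae_tendsto_popt (h : IsRun μ 𝓜 Q ν V α U pRand σRand ε ℱ S ξ K)
    (hp : pRand ∈ Set.Icc (0 : ℝ) 1) (hLip : ∀ m, LipschitzLogLik (𝓜.logLik m))
    (hV : ∀ m, Measurable (Function.uncurry (V m))) {m : M} {q σ l : ℝ}
    (hConc : ConcaveOn ℝ Set.univ (𝓜.logLik m)) (hCoer : CoerciveLogLik (𝓜.logLik m))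
    (hFlat : AsymptoticallyFlatCond (𝓜.logLik m))
    (hOracle : IsFirstOrderOracle ν (𝓜.logLik m) (V m) q σ) (hl0 : 0 < l) (hl1 : l ≤ 1)
    (hα : IsStepSize (α m) l) (hε : 0 < ε) (hε_le : ε ≤ 𝓜.targetLik m) :
    ∀ᵐ ω ∂μ, Tendsto (fun s => (S s ω).popt m) atTop (𝓝 (𝓜.targetLik m)) := by
  have hℓ : ∀ m, Continuous (𝓜.logLik m) := fun m => (hLip m).1.continuous
  have hmle := 𝓜.logLik_le_mle (hℓ m) hCoer
  have hpos : 0 < 𝓜.targetLik m := hε.trans_le hε_le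
  obtain ⟨G, hG⟩ := (hLip m).2.1
  have hgood : ∀ k : ℕ, ∀ᵐ ω ∂μ, ∃ s,
      𝓜.targetLik m * Real.exp (-(1 / ((k : ℝ) + 1))) ≤ (S s ω).popt m := by
    intro k
    -- One half of the tolerance is for the gap, the other half for the randomisation.
    set δ : ℝ := 1 / ((k : ℝ) + 1) / 2 with hδ
    have hδ0 : 0 < δ := by positivity
    have hη : 0 < δ / (G + 1) := by positivity
    have hBm : ∀ s, MeasurableSet[bsgdHistory ℱ ξ s] {ω | (ξ s ω).1.2 = m ∧
        𝓜.gap m ((S (s + 1) ω).theta m) < ENNReal.ofReal δ} := by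
      intro s
      obtain ⟨-, hθ, hτ, -⟩ := h.measurable_state hℓ hV s
      have h1 : Measurable[bsgdHistory ℱ ξ s] fun ω => (ξ s ω).1 :=
        measurable_iff_comap_le.2 (le_sup_right.trans le_sup_left)
      exact (h1 (.of_discrete (s := {y | y.2 = m}))).inter
        (((𝓜.measurable_gap (hℓ m)).comp (h.measurable_theta_succ hV s (hθ m) (hτ m)))
          measurableSet_Iio)
    filter_upwards [h.ae_frequently_gap_lt hp hLip hV hConc hCoer hFlat hOracle hl0 hl1 hα hδ0,
      h.ae_frequently_proposal hp m, h.ae_frequently_and_noise_small hp m hη hBm] with ω h1 h2 h3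
    obtain ⟨s, ⟨hm, hgap⟩, hz⟩ := (h3 (h.frequently_proposal_and_gap_lt h2 h1)).exists
    refine ⟨s + 1, ?_⟩
    rw [h.popt_succ, if_pos hm.symm]
    refine le_max_of_le_right (𝓜.targetLik_mul_exp_neg_le_evalLik hpos (by positivity) ?_)
    have hgap' : 𝓜.logLik m (𝓜.mle m) - 𝓜.logLik m ((S (s + 1) ω).theta m) < δ :=
      (ENNReal.ofReal_lt_ofReal_iff hδ0).1 hgap
    have hk : 1 / ((k : ℝ) + 1) = δ + δ := by rw [hδ]; ring
    split_ifs
    · have h5 := hG.norm_sub_le ((S (s + 1) ω).theta m)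
        ((S (s + 1) ω).theta m + σRand • (ξ s ω).2.2.2.1 m)
      rw [sub_add_cancel_left, norm_neg] at h5
      have h6 : (G : ℝ) * ‖σRand • (ξ s ω).2.2.2.1 m‖ ≤ δ := by
        calc (G : ℝ) * ‖σRand • (ξ s ω).2.2.2.1 m‖ ≤ (G + 1) * (δ / (G + 1)) := by
              gcongr; linarith
          _ = δ := by field_simp
      have h7 := (le_abs_self _).trans (h5.trans h6)
      linarith
    · linarith
  filter_upwards [ae_all_iff.2 hgood] with ω hω
  refine tendsto_order.2 ⟨fun x hx => ?_, fun x hx => Eventually.of_forall fun s =>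
    (h.popt_le_targetLik hmle hε_le s ω).trans_lt hx⟩
  have hlim : Tendsto (fun k : ℕ => 𝓜.targetLik m * Real.exp (-(1 / ((k : ℝ) + 1)))) atTop
      (𝓝 (𝓜.targetLik m)) := by
    have := (((Real.continuous_exp.tendsto _).comp
      tendsto_one_div_add_atTop_nhds_zero_nat.neg).const_mul (𝓜.targetLik m))
    simpa using this
  obtain ⟨k, hk⟩ := (hlim.eventually (lt_mem_nhds hx)).exists
  obtain ⟨s₀, hs₀⟩ := hω k
  exact eventually_atTop.2 ⟨s₀, fun s hs => hk.trans_le (hs₀.trans (h.monotone_popt ω m hs))⟩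

/-! ### The transitions of the chain in the long run -/

/-- The law of large numbers for the inputs: events for the input of an iteration occur with the
average of their conditional probabilities. -/
lemma ae_tendsto_average_input (h : IsRun μ 𝓜 Q ν V α U pRand σRand ε ℱ S ξ K)
    (hp : pRand ∈ Set.Icc (0 : ℝ) 1) (hℓ : ∀ m, Continuous (𝓜.logLik m))
    (hV : ∀ m, Measurable (Function.uncurry (V m))) {B : M → Set (Input R W 𝓜.dim)}
    (hB : ∀ m, MeasurableSet (B m)) :
    ∀ᵐ ω ∂μ, Tendsto (fun t : ℕ => (t : ℝ)⁻¹ * ∑ s ∈ Finset.range t,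
      ((B (S s ω).model).indicator (fun _ => (1 : ℝ)) (ξ s ω)
        - (inputLaw Q ν pRand 𝓜.dim (S s ω).model).real (B (S s ω).model))) atTop (𝓝 0) := by
  have := fun x => isProbabilityMeasure_inputLaw ν 𝓜.dim Q hp x
  have hX : ∀ s, Measurable[ℱ s] fun ω => (S s ω).model := fun s =>
    (h.measurable_state hℓ hV s).1
  have hXm : ∀ s m, MeasurableSet[ℱ s] {ω | (S s ω).model = m} := fun s m =>
    hX s (.of_discrete (s := {m}))
  set f : ℕ → Ω → ℝ := fun s ω => (B (S s ω).model).indicator (fun _ => (1 : ℝ)) (ξ s ω) with hf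
  set g : ℕ → Ω → ℝ := fun s ω =>
    (inputLaw Q ν pRand 𝓜.dim (S s ω).model).real (B (S s ω).model) with hg
  have hgm : ∀ s, StronglyMeasurable[ℱ s] (g s) := fun s =>
    ((Measurable.of_discrete (f := fun m => (inputLaw Q ν pRand 𝓜.dim m).real (B m))).comp
      (hX s)).stronglyMeasurable
  have hfsum : ∀ s, f s = ∑ m, {ω | (S s ω).model = m}.indicator
      ((ξ s ⁻¹' B m).indicator fun _ => (1 : ℝ)) := by
    intro s
    ext ω
    rw [Finset.sum_apply, Finset.sum_eq_single (S s ω).model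
      (fun m _ hm => Set.indicator_of_notMem (fun h1 => hm h1.symm) _) (by simp),
      Set.indicator_of_mem (by simp)]
    rfl
  have hfm : ∀ s, StronglyMeasurable[ℱ (s + 1)] (f s) := by
    intro s
    rw [hfsum]
    refine Finset.stronglyMeasurable_sum _ fun m _ => ?_
    exact (StronglyMeasurable.indicator (stronglyMeasurable_const.indicator
      (h.input_measurable s (hB m))) (ℱ.mono s.le_succ _ (hXm s m)))
  have hfb : ∀ s ω, f s ω ∈ Set.Icc (0 : ℝ) 1 := by
    intro s ω
    simp only [hf]
    by_cases hmem : ξ s ω ∈ B (S s ω).model <;> simp [hmem]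
  have hgb : ∀ s ω, g s ω ∈ Set.Icc (0 : ℝ) 1 := fun s ω =>
    ⟨measureReal_nonneg, measureReal_le_one⟩
  have hfint : ∀ s, Integrable (f s) μ := fun s =>
    Integrable.of_bound ((hfm s).mono (ℱ.le _)).aestronglyMeasurable 1 (ae_of_all _ fun ω => by
      rw [Real.norm_of_nonneg (hfb s ω).1]; exact (hfb s ω).2)
  have hgint : ∀ s, Integrable (g s) μ := fun s =>
    Integrable.of_bound ((hgm s).mono (ℱ.le _)).aestronglyMeasurable 1 (ae_of_all _ fun ω => by
      rw [Real.norm_of_nonneg (hgb s ω).1]; exact (hgb s ω).2)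
  have hcond : ∀ s, μ[f s | ℱ s] =ᵐ[μ] g s := by
    intro s
    have hint : ∀ m, Integrable ((ξ s ⁻¹' B m).indicator fun _ => (1 : ℝ)) μ := fun m =>
      (integrable_const _).indicator (h.measurable_input s (hB m))
    rw [hfsum]
    refine (condExp_finsetSum (fun m _ => (hint m).indicator (ℱ.le s _ (hXm s m))) (ℱ s)).trans ?_
    filter_upwards [ae_all_iff.2 fun m => condExp_indicator (hint m) (hXm s m),
      ae_all_iff.2 fun m => h.input_law s (B m) (hB m)] with ω h1 h2
    rw [Finset.sum_apply, Finset.sum_eq_single (S s ω).model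
      (fun m _ hm => by rw [h1 m, Set.indicator_of_notMem (fun h3 => hm h3.symm)]) (by simp), h1,
      Set.indicator_of_mem (by simp), h2]
  refine ae_tendsto_average_zero (D := fun s => f s - g s) (ℱ := ℱ)
    (fun s => (hfm s).sub ((hgm s).mono (ℱ.mono s.le_succ))) (fun s ω => ?_) (fun s => ?_)
  · have h1 := hfb s ω
    have h2 := hgb s ω
    rw [Pi.sub_apply, abs_le]
    exact ⟨by linarith [h1.1, h2.2], by linarith [h1.2, h2.1]⟩
  · refine (condExp_sub (hfint s) (hgint s) (ℱ s)).trans ?_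
    have h3 : μ[g s | ℱ s] = g s := condExp_of_stronglyMeasurable (ℱ.le s) (hgm s) (hgint s)
    filter_upwards [hcond s] with ω hω
    rw [Pi.sub_apply, hω, h3, sub_self]; rfl

/-- The chain moves like the limiting chain, except in iterations whose frequency tends to zero:
when the acceptance probabilities differ by at most `η`, the uniform variable decides differently
only if it is within `η` of the limiting probability. -/
lemma ae_tendsto_average_transition (h : IsRun μ 𝓜 Q ν V α U pRand σRand ε ℱ S ξ K)
    (hp : pRand ∈ Set.Icc (0 : ℝ) 1) (hℓ : ∀ m, Continuous (𝓜.logLik m))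
    (hV : ∀ m, Measurable (Function.uncurry (V m))) (hL : ∀ m, 0 < 𝓜.targetLik m)
    (hpopt : ∀ m, ∀ᵐ ω ∂μ, Tendsto (fun s => (S s ω).popt m) atTop (𝓝 (𝓜.targetLik m))) (m' : M) :
    ∀ᵐ ω ∂μ, Tendsto (fun t : ℕ => (t : ℝ)⁻¹ * ∑ s ∈ Finset.range t,
      ((if (S (s + 1) ω).model = m' then 1 else 0)
        - limitKernel 𝓜 Q ν pRand (S s ω).model m')) atTop (𝓝 0) := by
  set A : ℕ → M → R → M → Set ℝ := fun k m r m'' =>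
    {u | |u - acceptProb 𝓜 Q 𝓜.targetLik r m m''| ≤ 1 / ((k : ℝ) + 1)} with hA
  have hAm : ∀ k m r m'', MeasurableSet (A k m r m'') := fun k m r m'' =>
    measurableSet_le (by fun_prop) measurable_const
  set B : ℕ → M → Set (Input R W 𝓜.dim) := fun k m =>
    {x | x.2.2.2.2 ∈ A k m x.1.1 x.1.2} with hBdef
  have hBm : ∀ k m, MeasurableSet (B k m) := fun k m => measurableSet_uniform_mem (hAm k m)
  have hBle : ∀ k m, (inputLaw Q ν pRand 𝓜.dim m).real (B k m) ≤ 2 * (1 / ((k : ℝ) + 1)) := by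
    intro k m
    rw [hBdef, inputLaw_real_uniform_mem Q ν 𝓜.dim hp m (hAm k m)]
    calc ∑ r, ∑ m', Q.weight r * Q.q r m m'
          * (volume.restrict (Set.Icc (0 : ℝ) 1)).real (A k m r m')
        ≤ ∑ r, ∑ m', Q.weight r * Q.q r m m' * (2 * (1 / ((k : ℝ) + 1))) := by
          refine Finset.sum_le_sum fun r _ => Finset.sum_le_sum fun m' _ => ?_
          refine mul_le_mul_of_nonneg_left (uniform_real_abs_sub_le _ (by positivity)) ?_
          exact mul_nonneg (Q.weight_pos r).le (Q.q_nonneg r m m')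
      _ = _ := by
          simp_rw [← Finset.sum_mul, ← Finset.mul_sum, Q.q_sum, mul_one, Q.weight_sum, one_mul]
  filter_upwards [ae_all_iff.2 hpopt,
    ae_all_iff.2 fun k => h.ae_tendsto_average_input hp hℓ hV (hBm k),
    h.ae_tendsto_average_input hp hℓ hV fun m => measurableSet_nextModel_eq 𝓜 Q m m']
    with ω h1 h2 h3
  have hacc : ∀ r m m'', Tendsto (fun s => acceptProb 𝓜 Q (S (s + 1) ω).popt r m m'') atTop
      (𝓝 (acceptProb 𝓜 Q 𝓜.targetLik r m m'')) := fun r m m'' =>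
    tendsto_acceptProb Q hL (p := fun s => (S (s + 1) ω).popt)
      (fun m => (h1 m).comp (tendsto_add_atTop_nat 1)) r m m''
  have hdiff : Tendsto (fun t : ℕ => (t : ℝ)⁻¹ * ∑ s ∈ Finset.range t,
      ((if (S (s + 1) ω).model = m' then (1 : ℝ) else 0)
        - if nextModel 𝓜 Q (S s ω).model (ξ s ω) = m' then 1 else 0)) atTop (𝓝 0) := by
    refine tendsto_average_zero_of_dominated
      (b := fun k s => (B k (S s ω).model).indicator (fun _ => (1 : ℝ)) (ξ s ω))
      (p := fun k s => (inputLaw Q ν pRand 𝓜.dim (S s ω).model).real (B k (S s ω).model))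
      (fun s => ?_) (fun k s => Set.indicator_nonneg (fun _ _ => zero_le_one) _)
      (fun k s => hBle k _) (fun k => ?_) h2
    · split_ifs <;> simp
    · have hclose : ∀ᶠ s in atTop, ∀ y : R × M × M,
          |acceptProb 𝓜 Q (S (s + 1) ω).popt y.1 y.2.1 y.2.2
            - acceptProb 𝓜 Q 𝓜.targetLik y.1 y.2.1 y.2.2| < 1 / ((k : ℝ) + 1) :=
        eventually_all.2 fun y => Metric.tendsto_nhds.1 (hacc y.1 y.2.1 y.2.2) _ (by positivity)
      filter_upwards [hclose] with s hs
      by_cases hmem : ξ s ω ∈ B k (S s ω).model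
      · rw [Set.indicator_of_mem hmem]
        split_ifs <;> simp
      · have hnear := hs ((ξ s ω).1.1, (S s ω).model, (ξ s ω).1.2)
        have hfar : 1 / ((k : ℝ) + 1) < |(ξ s ω).2.2.2.2
            - acceptProb 𝓜 Q 𝓜.targetLik (ξ s ω).1.1 (S s ω).model (ξ s ω).1.2| :=
          not_le.1 hmem
        have heq : (S (s + 1) ω).model = nextModel 𝓜 Q (S s ω).model (ξ s ω) := by
          rw [h.model_succ, nextModel]
          refine if_congr ?_ rfl rfl
          simp only at hnear
          rw [abs_lt] at hnear
          rcases lt_abs.1 hfar with h4 | h4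
          · exact ⟨fun h5 => by linarith [hnear.2], fun h5 => by
              have : (0 : ℝ) < 1 / ((k : ℝ) + 1) := by positivity
              linarith⟩
          · exact ⟨fun h5 => by
              have : (0 : ℝ) < 1 / ((k : ℝ) + 1) := by positivity
              linarith, fun h5 => by linarith [hnear.1]⟩
        rw [heq, sub_self, abs_zero]
        exact Set.indicator_nonneg (fun _ _ => zero_le_one) _
  have hsum := hdiff.add h3
  rw [add_zero] at hsum
  refine hsum.congr fun t => ?_
  rw [← mul_add, ← Finset.sum_add_distrib]
  congr 1
  refine Finset.sum_congr rfl fun s _ => ?_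
  simp only [limitKernel, Set.indicator_apply, Set.mem_ofPred_eq]
  ring

end IsRun

end Run

theorem mainTheorem3
    {M R W Ω : Type*} [Fintype M] [DecidableEq M] [MeasurableSpace M] [DiscreteMeasurableSpace M]
    [Fintype R] [MeasurableSpace R] [DiscreteMeasurableSpace R] [MeasurableSpace W]
    [mΩ : MeasurableSpace Ω] (μ : Measure Ω) [IsProbabilityMeasure μ]
    (𝓜 : ModelFamily M) (Q : ProposalMixture R M)
    (ν : Measure W) [IsProbabilityMeasure ν]
    (V : (m : M) → Params (𝓜.dim m) → W → Params (𝓜.dim m))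
    (α : M → ℕ → ℝ) (q σ l : M → ℝ) (U : ℕ) (pRand σRand ε : ℝ)
    -- regularity of the log-likelihoods
    (hLip : ∀ m, LipschitzLogLik (𝓜.logLik m))
    (hConc : ∀ m, StrictConcaveOn ℝ Set.univ (𝓜.logLik m))
    (hCoer : ∀ m, CoerciveLogLik (𝓜.logLik m))
    (hFlat : ∀ m, AsymptoticallyFlatCond (𝓜.logLik m))
    (hOracle : ∀ m, IsFirstOrderOracle ν (𝓜.logLik m) (V m) (q m) (σ m))
    -- step sizes and the other constants of the algorithm
    (hl : ∀ m, l m ∈ Set.Ioc (2 / (q m + 2)) 1)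
    (hα : ∀ m, IsStepSize (α m) (l m))
    (hpRand : pRand ∈ Set.Icc (0 : ℝ) 1) (hσRand : 0 ≤ σRand)
    (hε : 0 < ε) (hε_le : ∀ m, ε ≤ 𝓜.targetLik m)
    -- a run of the algorithm
    (ℱ : Filtration ℕ mΩ) (S : ℕ → Ω → AlgState 𝓜.dim)
    (ξ : ℕ → Ω → Input R W 𝓜.dim) (K : ℕ → Ω → ℕ)
    (hrun : IsRun μ 𝓜 Q ν V α U pRand σRand ε ℱ S ξ K) :
    ∀ᵐ ω ∂μ, ∀ m, Tendsto (fun t : ℕ => mcEstimate (fun s => (S s ω).model) t m)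
      atTop (𝓝 (𝓜.target m)) := by
  have hℓ : ∀ m, Continuous (𝓜.logLik m) := fun m => (hLip m).1.continuous
  have hV : ∀ m, Measurable (Function.uncurry (V m)) := fun m => (hOracle m).measurable
  have hL : ∀ m, 0 < 𝓜.targetLik m := fun m => hε.trans_le (hε_le m)
  have hpopt : ∀ m, ∀ᵐ ω ∂μ, Tendsto (fun s => (S s ω).popt m) atTop (𝓝 (𝓜.targetLik m)) := by
    intro m
    have hq := (hOracle m).two_le
    have hl0 : 0 < l m := lt_trans (by positivity) (hl m).1
    exact hrun.ae_tendsto_popt hpRand hLip hV (hConc m).concaveOn (hCoer m) (hFlat m) (hOracle m)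
      hl0 (hl m).2 (hα m) hε (hε_le m)
  obtain ⟨c, hc, hcP⟩ := exists_pos_le_limitKernel Q ν hpRand hL
  filter_upwards [ae_all_iff.2 fun m' =>
    hrun.ae_tendsto_average_transition hpRand hℓ hV hL hpopt m'] with ω hω m
  exact tendsto_mcEstimate_of_reversible (P := limitKernel 𝓜 Q ν pRand) (ϖ := 𝓜.target)
    (X := fun s => (S s ω).model) hc (limitKernel_nonneg Q ν) (sum_limitKernel Q ν hpRand) hcP
    (target_pos hL) (sum_target hL) (target_mul_limitKernel Q ν hpRand hL) hω m
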